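/- A \emph{convex polyhedron} is a bounded subset of $\mathbb{R}^3$ with nonempty interior that is the intersection of finitely many half-spaces. It is \emph{$k$-equiprojective} if its orthogonal projection in every direction not parallel to one of its faces is a convex polygon with exactly $k$ vertices. Let $P$ be a triangular cupola (the Johnson solid with regular faces, of any size and in any position), with top triangle $a_1a_2a_3$ and regular hexagonal base $b_0b_1b_2b_3b_4b_5$ (in cyclic order), whose remaining faces are the squares $a_2a_3b_1b_0$, $a_3a_1b_3b_2$, $a_1a_2b_5b_4$ and the triangles $t_1=a_1b_3b_4$, $t_2=a_2b_5b_0$, $t_3=a_3b_1b_2$. The edges not in the base form three planar paths $\mathcal P_1=b_2a_3a_2b_5$, $\mathcal P_2=b_1a_3a_1b_4$, $\mathcal P_3=b_0a_2a_1b_3$, the plane of $\mathcal P_i$ being parallel to $t_i$. Cut $P$ by five planes, each time discarding one side of the plane, as follows. 1. (cut1) A plane parallel to $t_1$ that crosses the end edges $a_3b_1$ of $\mathcal P_2$ and $a_2b_0$ of $\mathcal P_3$ at interior points; the side of $b_0,b_1$ is discarded. 2. (cut2, a pair) Two planes perpendicular to the base and to the plane of $t_1$, one crossing the end edge $a_3b_2$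 of $\mathcal P_1$ at an interior point, the side of $b_2$ being discarded, the other crossing the end edge $a_2b_5$ of $\mathcal P_1$ at an interior point, the side of $b_5$ being discarded. 3. (cut3) A plane parallel to the base and strictly between the base and the top triangle; the side of the top triangle is discarded. 4. (cut4) A plane that strictly separates the vertex $a_1$ (the common vertex of $\mathcal P_2$ and $\mathcal P_3$) from all other vertices of $P$, and whose intersection with the solid left by the preceding cuts is a (nondegenerate) rectangle; the side of $a_1$ is discarded. Assume that the cuts do not run into one another: among the plane sections of $P$ made by cut1, by the two planes of cut2 and by cut3, the section of cut1 is disjoint from those of the two cut2 and of cut3, and the sections of the two cut2 are disjoint from that of cut3. Then the resulting solid, called an equitruncated triangular cupola, is $11$-equiprojective. -/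

import Mathlib

/-- Euclidean three-space. -/
abbrev E3 : Type := EuclideanSpace ℝ (Fin 3)

/-! ### Half-spaces, polyhedra, faces, polygons, shadows -/

/-- A plane `{x | ⟪normal, x⟫ = offset}` together with one of its sides,
the side `⟪normal, x⟫ ≤ offset`. -/
structure HalfSpace where
  normal : E3
  offset : ℝ
  normal_ne_zero : normal ≠ 0

namespace HalfSpace

/-- The closed half-space. -/
def carrier (H : HalfSpace) : Set E3 := {x | inner ℝ H.normal x ≤ H.offset}

/-- The bounding plane. -/
def plane (H : HalfSpace) : Set E3 := {x | inner ℝ H.normal x = H.offset}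

/-- The vectors parallel to the bounding plane. -/
noncomputable def direction (H : HalfSpace) : Submodule ℝ E3 := (Submodule.span ℝ {H.normal})ᗮ

/-- `x` lies strictly on the side that is kept. -/
def Keeps (H : HalfSpace) (x : E3) : Prop := inner ℝ H.normal x < H.offset

/-- `x` lies strictly on the side that is cut away. -/
def Removes (H : HalfSpace) (x : E3) : Prop := H.offset < inner ℝ H.normal x

end HalfSpace

/-- A (bounded, three-dimensional) convex polyhedron: a bounded intersection of finitely many
half-spaces with nonempty interior. -/
def IsConvexPolyhedron (P : Set E3) : Prop :=
  (∃ (n : ℕ) (H : Fin n → HalfSpace), P = ⋂ i, (H i).carrier) ∧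
    Bornology.IsBounded P ∧ (interior P).Nonempty

/-- A face (facet) of `P`: an exposed subset of `P` of affine dimension two. -/
def IsFace (P F : Set E3) : Prop :=
  IsExposed ℝ P F ∧ Module.finrank ℝ (vectorSpan ℝ F) = 2

/-- `Q` is a convex polygon with exactly `k` vertices (the convex hull of finitely many points,
of affine dimension two, with `k` extreme points). -/
def IsConvexPolygon (k : ℕ) (Q : Set E3) : Prop :=
  (∃ s : Finset E3, Q = convexHull ℝ (s : Set E3)) ∧
    Module.finrank ℝ (vectorSpan ℝ Q) = 2 ∧ (Set.extremePoints ℝ Q).ncard = k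

/-- The shadow of `P` in direction `u`: its orthogonal projection to the plane orthogonal
to `u`. -/
noncomputable def shadow (u : E3) (P : Set E3) : Set E3 :=
  (Submodule.span ℝ {u})ᗮ.starProjection '' P

/-- `P` is a convex polyhedron whose shadow is a `k`-gon in every direction that is not
parallel to a face of `P`. -/
def IsEquiprojective (k : ℕ) (P : Set E3) : Prop :=
  IsConvexPolyhedron P ∧
    ∀ u : E3, u ≠ 0 → (∀ F : Set E3, IsFace P F → u ∉ vectorSpan ℝ F) →
      IsConvexPolygon k (shadow u P)

/-- A (nondegenerate) rectangle with corner `p` and orthogonal sides `v`, `w`. -/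
def IsRectangle (R : Set E3) : Prop :=
  ∃ p v w : E3, v ≠ 0 ∧ w ≠ 0 ∧ inner ℝ v w = 0 ∧
    R = {x | ∃ s t : ℝ, 0 ≤ s ∧ s ≤ 1 ∧ 0 ≤ t ∧ t ≤ 1 ∧ x = p + s • v + t • w}

/-! ### The triangular cupola -/

/-- The top triangle of the model cupola with edge length `√2`, one half of the cuboctahedron
whose vertices are the permutations of `(±1, ±1, 0)`. -/
noncomputable def cupolaTop : Fin 3 → E3 :=
  ![!₂[0, 1, 1], !₂[1, 0, 1], !₂[1, 1, 0]]

/-- The base hexagon of the model cupola, in cyclic order. -/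
noncomputable def cupolaBase : Fin 6 → E3 :=
  ![!₂[1, -1, 0], !₂[1, 0, -1], !₂[0, 1, -1], !₂[-1, 1, 0], !₂[-1, 0, 1], !₂[0, -1, 1]]

/-- A triangular cupola (the Johnson solid with regular faces, of any size and in any position),
with its vertices labelled: top triangle `a 0, a 1, a 2`, base hexagon `b 0, …, b 5`.
The other faces are
* the squares `a 1, a 2, b 1, b 0` and `a 2, a 0, b 3, b 2` and `a 0, a 1, b 5, b 4`;
* the triangles `t₁ = a 0, b 3, b 4` and `t₂ = a 1, b 5, b 0` and `t₃ = a 2, b 1, b 2`.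

The edges outside the base form the three planar paths
`𝒫₁ = b 2, a 2, a 1, b 5`, `𝒫₂ = b 1, a 2, a 0, b 4` and `𝒫₃ = b 0, a 1, a 0, b 3`,
the plane of `𝒫ᵢ` being parallel to `tᵢ`. The common vertex of `𝒫₂` and `𝒫₃` is `a 0`. -/
structure TriangularCupola where
  a : Fin 3 → E3
  b : Fin 6 → E3
  similar_model : ∃ f : E3 ≃ᵈ E3, (∀ i, a i = f (cupolaTop i)) ∧ ∀ i, b i = f (cupolaBase i)

namespace TriangularCupola

/-- The solid cupola. -/
def solid (C : TriangularCupola) : Set E3 := convexHull ℝ (Set.range C.a ∪ Set.range C.b)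

/-- The vectors parallel to the base. -/
noncomputable def baseDirection (C : TriangularCupola) : Submodule ℝ E3 := vectorSpan ℝ (Set.range C.b)

/-- The vectors parallel to the triangle `t₁`. -/
noncomputable def t₁Direction (C : TriangularCupola) : Submodule ℝ E3 := vectorSpan ℝ {C.a 0, C.b 3, C.b 4}

/-- The cuts that turn a triangular cupola into an equitruncated one. Each cut is given by its
plane and the side that is kept. -/
structure Equitruncation (C : TriangularCupola) where
  cut1 : HalfSpace
  cut2 : HalfSpace
  cut2' : HalfSpace
  cut3 : HalfSpace
  cut4 : HalfSpace
  /-- cut1 is parallel to `t₁`. -/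
  cut1_parallel : cut1.direction = C.t₁Direction
  /-- cut1 cuts the end edge `a 2, b 1` of `𝒫₂` between its ends. -/
  cut1_edge₂ : cut1.Keeps (C.a 2) ∧ cut1.Removes (C.b 1)
  /-- cut1 cuts the end edge `a 1, b 0` of `𝒫₃` between its ends. -/
  cut1_edge₃ : cut1.Keeps (C.a 1) ∧ cut1.Removes (C.b 0)
  /-- The two planes of cut2 are perpendicular to the base and to the plane of `t₁`. -/
  cut2_perp : cut2.normal ∈ C.baseDirection ∧ cut2.normal ∈ C.t₁Direction
  cut2'_perp : cut2'.normal ∈ C.baseDirection ∧ cut2'.normal ∈ C.t₁Direction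
  /-- They cut the two end edges `a 2, b 2` and `a 1, b 5` of `𝒫₁` between their ends. -/
  cut2_edge : cut2.Keeps (C.a 2) ∧ cut2.Removes (C.b 2)
  cut2'_edge : cut2'.Keeps (C.a 1) ∧ cut2'.Removes (C.b 5)
  /-- cut3 is parallel to the base and cuts off the top triangle. -/
  cut3_parallel : cut3.direction = C.baseDirection
  cut3_top : (∀ i, cut3.Removes (C.a i)) ∧ ∀ i, cut3.Keeps (C.b i)
  /-- cut4 cuts off the common vertex `a 0` of `𝒫₂` and `𝒫₃`, and no other vertex of `C`. -/
  cut4_vertex : cut4.Removes (C.a 0) ∧ (∀ i, i ≠ 0 → cut4.Keeps (C.a i)) ∧ ∀ i, cut4.Keeps (C.b i)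
  /-- cut4 creates a rectangle in the resulting solid. -/
  cut4_rectangle : IsRectangle
    (C.solid ∩ cut1.carrier ∩ cut2.carrier ∩ cut2'.carrier ∩ cut3.carrier ∩ cut4.plane)
  /-- The plane sections of the cupola made by cut1, by the two cut2 and by cut3 do not run
  into one another. -/
  disjoint_cut1_cut2 : Disjoint (C.solid ∩ cut1.plane) (C.solid ∩ cut2.plane)
  disjoint_cut1_cut2' : Disjoint (C.solid ∩ cut1.plane) (C.solid ∩ cut2'.plane)
  disjoint_cut1_cut3 : Disjoint (C.solid ∩ cut1.plane) (C.solid ∩ cut3.plane)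
  disjoint_cut2_cut3 : Disjoint (C.solid ∩ cut2.plane) (C.solid ∩ cut3.plane)
  disjoint_cut2'_cut3 : Disjoint (C.solid ∩ cut2'.plane) (C.solid ∩ cut3.plane)

/-- The equitruncated triangular cupola: what the cuts leave of the cupola. -/
def Equitruncation.solid {C : TriangularCupola} (K : C.Equitruncation) : Set E3 :=
  C.solid ∩ K.cut1.carrier ∩ K.cut2.carrier ∩ K.cut2'.carrier ∩ K.cut3.carrier ∩ K.cut4.carrier

end TriangularCupola

/-!
A vertex of a simple polytope is seen as a vertex of the shadow in a direction `u` parallel to no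
facet exactly when the facet normals at it take both signs on `u`. At a vertex with three facets
the number of sign changes between pairs of facet normals is then `2`, and otherwise it is `0`, so
the number of vertices of the shadow is half the number of sign changes summed over all vertices.
The truncated cupola is simple and its combinatorial type and facet normals do not depend on where
the planes of the cuts lie. Its facets come in parallel pairs (the base and cut3, `t₁` and cut1,
the two cut2): a facet adjacent to both members of a pair contributes exactly one sign change to
the two adjacencies together. Where a facet normal is a positive combination of two others, its
sign changes against these two add up to the sign change between them. With these two rules the sum
is always `22`.

The rectangle determines the direction of cut4. Two opposite sides of it lie in two of the four
facets around the corner that cut4 removes, so their direction is that of the line in which these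
two facets meet. It is not that of an edge at `a 0`, as cut4 separates the ends of every such edge;
hence the two facets are opposite at the corner. The lines belonging to the two pairs of opposite
facets span a plane direction, which is therefore that of cut4.
-/

open Set Filter Topology Module

/-! ### Simple polytopes -/

section Biorthogonal

variable {E ι : Type*} [AddCommGroup E] [Module ℝ E]

theorem linearIndependent_of_biorthogonal [Finite ι] {φ : ι → E →ₗ[ℝ] ℝ} {e : ι → E}
    (hne : ∀ k, φ k (e k) ≠ 0) (hzero : ∀ k l, k ≠ l → φ k (e l) = 0) :
    LinearIndependent ℝ e := by
  have := Fintype.ofFinite ι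
  refine Fintype.linearIndependent_iff.2 fun c hc k => ?_
  have hk : φ k (∑ l, c l • e l) = c k * φ k (e k) := by
    rw [map_sum, Finset.sum_eq_single k (fun l _ hl => by simp [hzero k l hl.symm]) (by simp)]
    simp
  rw [hc, map_zero] at hk
  exact (mul_eq_zero.1 hk.symm).resolve_right (hne k)

theorem eq_sum_div_smul_of_biorthogonal [Fintype ι] [FiniteDimensional ℝ E]
    {φ : ι → E →ₗ[ℝ] ℝ} {e : ι → E} (hne : ∀ k, φ k (e k) ≠ 0)
    (hzero : ∀ k l, k ≠ l → φ k (e l) = 0) (hcard : Fintype.card ι = finrank ℝ E) (w : E) :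
    w = ∑ k, (φ k w / φ k (e k)) • e k := by
  have hindep := linearIndependent_of_biorthogonal hne hzero
  have hspan := hindep.span_eq_top_of_card_eq_finrank' hcard
  obtain ⟨c, rfl⟩ := (Submodule.mem_span_range_iff_exists_fun ℝ).1
    (hspan ▸ Submodule.mem_top (x := w))
  refine Finset.sum_congr rfl fun k _ => ?_
  rw [map_sum, Finset.sum_eq_single k (fun l _ hl => by simp [hzero k l hl.symm]) (by simp),
    map_smul, smul_eq_mul, mul_div_cancel_right₀ _ (hne k)]

end Biorthogonal

/-- If `α k = ∑ a⁻` where `a k > 0` and `α k = ∑ a⁺` elsewhere, the weighted sum vanishes. -/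
theorem exists_pos_weights_sum_mul_eq_zero {κ : Type*} {s : Finset κ} {a : κ → ℝ}
    (hpos : ∃ k ∈ s, 0 < a k) (hneg : ∃ k ∈ s, a k < 0) :
    ∃ α : κ → ℝ, (∀ k, 0 < α k) ∧ ∑ k ∈ s, α k * a k = 0 := by
  set p := ∑ k ∈ s, (a k)⁺
  set n := ∑ k ∈ s, (a k)⁻
  have hp : 0 < p := Finset.sum_pos' (fun k _ => posPart_nonneg _)
    (hpos.imp fun k hk => ⟨hk.1, posPart_pos hk.2⟩)
  have hn : 0 < n := Finset.sum_pos' (fun k _ => negPart_nonneg _)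
    (hneg.imp fun k hk => ⟨hk.1, negPart_pos hk.2⟩)
  refine ⟨fun k => if 0 < a k then n else p, fun k => by beta_reduce; split_ifs <;> assumption, ?_⟩
  have hterm : ∀ k, (if 0 < a k then n else p) * a k = n * (a k)⁺ - p * (a k)⁻ := fun k => by
    split_ifs with h
    · rw [posPart_of_nonneg h.le, negPart_of_nonneg h.le]; ring
    · rw [posPart_of_nonpos (not_lt.1 h), negPart_of_nonpos (not_lt.1 h)]; ring
  simp only [hterm, Finset.sum_sub_distrib, ← Finset.mul_sum]
  ring

/-- A bounded polyhedron `{x | ∀ k, form k x ≤ bound k}` whose facets are indexed by `κ` and whose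
vertices are indexed by `ι`; `inc i` is the set of facets through the vertex `i`. The polytope is
simple: there are as many of them as the dimension, and leaving any one of them along the
remaining ones leads to another vertex. -/
structure SimplePolytope (κ ι E : Type*) [NormedAddCommGroup E] [NormedSpace ℝ E] where
  form : κ → E →L[ℝ] ℝ
  bound : κ → ℝ
  vertex : ι → E
  inc : ι → Finset κ
  form_eq : ∀ i, ∀ k ∈ inc i, form k (vertex i) = bound k
  form_lt : ∀ i, ∀ k ∉ inc i, form k (vertex i) < bound k
  card_inc : ∀ i, (inc i).card = finrank ℝ E
  inc_injective : Function.Injective inc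
  exists_mem_inc : ∀ k, ∃ i, k ∈ inc i
  exists_adjacent : ∀ i, ∀ k ∈ inc i, ∃ j, k ∉ inc j ∧ ∀ l ∈ inc i, l ≠ k → l ∈ inc j

namespace SimplePolytope

variable {κ ι E F : Type*} [NormedAddCommGroup E] [NormedSpace ℝ E]
  [NormedAddCommGroup F] [NormedSpace ℝ F]

section Basic

variable (S : SimplePolytope κ ι E)

/-- The polytope as a set of points. -/
def solid : Set E := {x | ∀ k, S.form k x ≤ S.bound k}

/-- The facet of `S` with index `k`. -/
def facet (k : κ) : Set E := {x ∈ S.solid | S.form k x = S.bound k}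

/-- The facet normals at the vertex `i` take both signs on `u`; for `u` parallel to no facet, this
says that the line through the vertex in direction `u` meets `S` in the vertex only. -/
def IsSilhouette (u : E) (i : ι) : Prop :=
  (∃ k ∈ S.inc i, 0 < S.form k u) ∧ ∃ k ∈ S.inc i, S.form k u < 0

theorem form_vertex_le (i : ι) (k : κ) : S.form k (S.vertex i) ≤ S.bound k := by
  by_cases h : k ∈ S.inc i
  exacts [(S.form_eq i k h).le, (S.form_lt i k h).le]

theorem vertex_mem_solid (i : ι) : S.vertex i ∈ S.solid := S.form_vertex_le i

theorem form_vertex_eq_iff {i : ι} {k : κ} :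
    S.form k (S.vertex i) = S.bound k ↔ k ∈ S.inc i :=
  ⟨fun h => by_contra fun hk => (S.form_lt i k hk).ne h, S.form_eq i k⟩

theorem vertex_injective : Function.Injective S.vertex := fun i j hij =>
  S.inc_injective <| Finset.ext fun k => by
    rw [← S.form_vertex_eq_iff, hij, S.form_vertex_eq_iff]

theorem convex_solid : Convex ℝ S.solid := by
  simp only [solid, ofPred_forall]
  exact convex_iInter fun k => convex_halfSpace_le (S.form k).isLinear _

theorem exists_notMem_inc (k : κ) : ∃ i, k ∉ S.inc i := by
  obtain ⟨i, hi⟩ := S.exists_mem_inc k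
  exact (S.exists_adjacent i k hi).imp fun _ h => h.1

theorem exists_mem_inc_notMem_inc {k l : κ} (hkl : k ≠ l) : ∃ i, k ∈ S.inc i ∧ l ∉ S.inc i := by
  obtain ⟨i, hk⟩ := S.exists_mem_inc k
  by_cases hl : l ∈ S.inc i
  · obtain ⟨j, hlj, hj⟩ := S.exists_adjacent i l hl
    exact ⟨j, hj k hk hkl, hlj⟩
  · exact ⟨i, hk, hl⟩

theorem form_ne_zero (k : κ) : S.form k ≠ 0 := by
  intro h
  obtain ⟨i, hi⟩ := S.exists_mem_inc k
  obtain ⟨j, hj⟩ := S.exists_notMem_inc k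
  have := S.form_lt j k hj
  simp [← S.form_eq i k hi, h] at this

theorem isExposed_facet (k : κ) : IsExposed ℝ S.solid (S.facet k) := fun _ => by
  obtain ⟨i, hi⟩ := S.exists_mem_inc k
  refine ⟨S.form k, Set.ext fun x => and_congr_right fun hx => ⟨fun h y hy => ?_, fun h => ?_⟩⟩
  · exact (hy k).trans h.ge
  · exact (hx k).antisymm (S.form_eq i k hi ▸ h _ (S.vertex_mem_solid i))

/-- The witness is the barycenter of the vertices in `s`. -/
theorem exists_mem_solid_form_eq_iff {s : Finset ι} (hs : s.Nonempty) :
    ∃ x ∈ S.solid, ∀ k, S.form k x = S.bound k ↔ ∀ i ∈ s, k ∈ S.inc i := by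
  have hcard : (0 : ℝ) < (s.card : ℝ)⁻¹ := by have := hs.card_pos; positivity
  have hform : ∀ k, S.form k ((s.card : ℝ)⁻¹ • ∑ i ∈ s, S.vertex i) - S.bound k =
      (s.card : ℝ)⁻¹ * ∑ i ∈ s, (S.form k (S.vertex i) - S.bound k) := fun k => by
    have : (s.card : ℝ) ≠ 0 := by simpa using hs.ne_empty
    simp only [map_smul, map_sum, smul_eq_mul, Finset.sum_sub_distrib, Finset.sum_const,
      nsmul_eq_mul]
    field_simp
  have hnonpos : ∀ k, ∀ i ∈ s, S.form k (S.vertex i) - S.bound k ≤ 0 :=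
    fun k i _ => sub_nonpos.2 (S.form_vertex_le i k)
  refine ⟨(s.card : ℝ)⁻¹ • ∑ i ∈ s, S.vertex i, fun k => sub_nonpos.1 ?_, fun k => ?_⟩
  · rw [hform]
    exact mul_nonpos_of_nonneg_of_nonpos hcard.le (Finset.sum_nonpos (hnonpos k))
  · rw [← sub_eq_zero, hform, mul_eq_zero_iff_left hcard.ne',
      Finset.sum_eq_zero_iff_of_nonpos (hnonpos k)]
    simp only [sub_eq_zero, S.form_vertex_eq_iff]

theorem exists_forall_form_lt [Finite ι] [Nonempty ι] : ∃ x, ∀ k, S.form k x < S.bound k := by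
  have := Fintype.ofFinite ι
  obtain ⟨x, hx, h⟩ := S.exists_mem_solid_form_eq_iff (Finset.univ_nonempty (α := ι))
  refine ⟨x, fun k => (hx k).lt_of_ne fun heq => ?_⟩
  obtain ⟨i, hi⟩ := S.exists_notMem_inc k
  exact hi ((h k).1 heq i (Finset.mem_univ i))

theorem exists_mem_facet_forall_form_lt [Finite ι] (k : κ) :
    ∃ x ∈ S.facet k, ∀ l, l ≠ k → S.form l x < S.bound l := by
  classical
  have := Fintype.ofFinite ι
  have hs : (Finset.univ.filter fun i => k ∈ S.inc i).Nonempty :=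
    (S.exists_mem_inc k).imp fun i hi => by simpa using hi
  obtain ⟨x, hx, h⟩ := S.exists_mem_solid_form_eq_iff hs
  refine ⟨x, ⟨hx, (h k).2 fun i hi => by simpa using hi⟩, fun l hl => (hx l).lt_of_ne fun heq => ?_⟩
  obtain ⟨i, hki, hli⟩ := S.exists_mem_inc_notMem_inc hl.symm
  exact hli ((h l).1 heq i (by simpa using hki))

theorem eventually_form_add_smul_lt [Finite κ] (x w : E) :
    ∀ᶠ r in 𝓝 (0 : ℝ), ∀ k, S.form k x < S.bound k → S.form k (x + r • w) < S.bound k := by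
  refine eventually_all.2 fun k => ?_
  by_cases hk : S.form k x < S.bound k
  · have hc : ContinuousAt (fun r : ℝ => S.form k (x + r • w)) 0 := by fun_prop
    filter_upwards [hc.eventually_lt continuousAt_const (by simpa using hk)] with r hr _ using hr
  · simp [hk]

theorem mem_interior_solid [Finite κ] {x : E} (hx : ∀ k, S.form k x < S.bound k) :
    x ∈ interior S.solid := by
  refine mem_interior.2 ⟨⋂ k, {y | S.form k y < S.bound k}, fun y hy k => ?_, ?_, ?_⟩
  · exact (mem_iInter.1 hy k).le
  · exact isOpen_iInter_of_finite fun k => isOpen_lt (S.form k).continuous continuous_const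
  · exact mem_iInter.2 hx

theorem interior_solid_nonempty [Finite κ] [Finite ι] [Nonempty ι] :
    (interior S.solid).Nonempty :=
  S.exists_forall_form_lt.imp fun _ hx => S.mem_interior_solid hx

theorem vectorSpan_solid [Finite κ] [Finite ι] [Nonempty ι] : vectorSpan ℝ S.solid = ⊤ := by
  have h := affineSpan_eq_top_of_nonempty_interior (s := S.solid)
    (S.convex_solid.convexHull_eq.symm ▸ S.interior_solid_nonempty)
  rw [← direction_affineSpan, h, AffineSubspace.direction_top]

theorem vectorSpan_facet [Finite κ] [Finite ι] (k : κ) :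
    vectorSpan ℝ (S.facet k) = (S.form k).ker := by
  apply le_antisymm
  · rw [vectorSpan_def, Submodule.span_le]
    rintro _ ⟨x, hx, y, hy, rfl⟩
    simp [hx.2, hy.2]
  · intro w hw
    obtain ⟨x, hx, hlt⟩ := S.exists_mem_facet_forall_form_lt k
    obtain ⟨r, hr, hr0⟩ := ((S.eventually_form_add_smul_lt x w).filter_mono
      nhdsWithin_le_nhds |>.and self_mem_nhdsWithin : ∀ᶠ r in 𝓝[≠] (0 : ℝ), _).exists
    have hk : S.form k (x + r • w) = S.bound k := by simp [hx.2, show S.form k w = 0 from hw]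
    have hmem : x + r • w ∈ S.facet k := by
      refine ⟨fun l => ?_, hk⟩
      rcases eq_or_ne l k with rfl | hl
      exacts [hk.le, (hr l (hlt l hl)).le]
    have hspan := vsub_mem_vectorSpan ℝ hmem hx
    rw [vsub_eq_sub, add_sub_cancel_left] at hspan
    exact (Submodule.smul_mem_iff _ hr0).1 hspan

theorem exists_forall_form_add_smul_lt [Finite κ] {u : E} (hu : ∀ k, S.form k u ≠ 0) {i : ι}
    (hi : ¬ S.IsSilhouette u i) : ∃ r : ℝ, ∀ k, S.form k (S.vertex i + r • u) < S.bound k := by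
  suffices key : ∀ w, (∀ k ∈ S.inc i, S.form k w < 0) →
      ∃ r : ℝ, ∀ k, S.form k (S.vertex i + r • w) < S.bound k by
    by_cases h : ∃ k ∈ S.inc i, 0 < S.form k u
    · obtain ⟨r, hr⟩ := key (-u) fun k hk => by
        rw [map_neg, neg_lt_zero]
        exact (hu k).lt_or_gt.resolve_left fun hneg => hi ⟨h, k, hk, hneg⟩
      exact ⟨-r, by simpa using hr⟩
    · push Not at h
      exact key u fun k hk => (h k hk).lt_of_ne (hu k)
  intro w hw
  obtain ⟨r, hr, hr0⟩ := ((S.eventually_form_add_smul_lt (S.vertex i) w).filter_mono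
    nhdsWithin_le_nhds |>.and self_mem_nhdsWithin : ∀ᶠ r in 𝓝[>] (0 : ℝ), _).exists
  refine ⟨r, fun k => ?_⟩
  by_cases hk : k ∈ S.inc i
  · rw [map_add, map_smul, S.form_eq i k hk, smul_eq_mul]
    linarith [mul_neg_of_pos_of_neg hr0 (hw k hk)]
  · exact hr k (S.form_lt i k hk)

theorem image_notMem_extremePoints [Finite κ] {π : E →L[ℝ] F} (hπ : π ≠ 0) {x : E}
    (hx : ∀ k, S.form k x < S.bound k) : π x ∉ extremePoints ℝ (π '' S.solid) := by
  intro hext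
  obtain ⟨w, hw⟩ : ∃ w, π w ≠ 0 := by
    by_contra! h
    exact hπ (ContinuousLinearMap.ext h)
  have hpos := S.eventually_form_add_smul_lt x w
  have hneg := S.eventually_form_add_smul_lt x (-w)
  obtain ⟨r, ⟨hr, hr'⟩, hr0⟩ := ((hpos.and hneg).filter_mono
    nhdsWithin_le_nhds |>.and self_mem_nhdsWithin : ∀ᶠ r in 𝓝[≠] (0 : ℝ), _).exists
  have h := hext.2 (mem_image_of_mem π fun k => (hr k (hx k)).le)
    (mem_image_of_mem π fun k => (hr' k (hx k)).le)
    ⟨1 / 2, 1 / 2, by norm_num, by norm_num, by norm_num,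
      by rw [← map_smul, ← map_smul, ← map_add]; congr 1; module⟩
  rw [map_add, add_eq_left, map_smul] at h
  exact hw ((smul_eq_zero.1 h).resolve_left hr0)

end Basic

section FiniteDimensional

variable [FiniteDimensional ℝ E] (S : SimplePolytope κ ι E)

theorem exists_edges (i : ι) : ∃ e : S.inc i → E,
    (∀ k, ∃ j, e k = S.vertex j - S.vertex i) ∧ (∀ k : S.inc i, S.form k (e k) < 0) ∧
      ∀ w, w = ∑ k : S.inc i, (S.form k w / S.form k (e k)) • e k := by
  choose j hj hadj using fun k : S.inc i => S.exists_adjacent i k k.2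
  have hneg : ∀ k : S.inc i, S.form k (S.vertex (j k) - S.vertex i) < 0 := fun k => by
    rw [map_sub, S.form_eq i k k.2]
    exact sub_neg.2 (S.form_lt _ _ (hj k))
  refine ⟨fun k => S.vertex (j k) - S.vertex i, fun k => ⟨j k, rfl⟩, hneg, ?_⟩
  refine eq_sum_div_smul_of_biorthogonal (φ := fun k : S.inc i => (S.form k : E →ₗ[ℝ] ℝ))
    (fun k => (hneg k).ne) (fun l k hlk => ?_) (by simpa using S.card_inc i)
  have hl : (l : κ) ∈ S.inc (j k) := hadj k l l.2 (Subtype.coe_injective.ne hlk)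
  simp [S.form_eq i l l.2, S.form_eq _ _ hl]

theorem eq_vertex_of_forall_form_eq {i : ι} {x : E}
    (hx : ∀ k ∈ S.inc i, S.form k x = S.bound k) : x = S.vertex i := by
  obtain ⟨e, -, -, hsum⟩ := S.exists_edges i
  rw [← sub_eq_zero, hsum (x - S.vertex i)]
  refine Finset.sum_eq_zero fun k _ => ?_
  rw [map_sub, hx k k.2, S.form_eq i k k.2, sub_self, zero_div, zero_smul]

/-- The optimality criterion of the simplex method: a vertex that no adjacent vertex improves upon
is a maximum, because the edges at it span the cone of feasible directions. -/
theorem apply_le_of_forall_vertex_le {i : ι} {f : E →L[ℝ] ℝ}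
    (hf : ∀ j, f (S.vertex j) ≤ f (S.vertex i)) {x : E} (hx : x ∈ S.solid) :
    f x ≤ f (S.vertex i) := by
  obtain ⟨e, hedge, hneg, hsum⟩ := S.exists_edges i
  rw [← sub_nonpos, ← map_sub, hsum (x - S.vertex i), map_sum]
  refine Finset.sum_nonpos fun k _ => ?_
  have hle : S.form k (x - S.vertex i) ≤ 0 := by
    rw [map_sub, S.form_eq i k k.2]
    exact sub_nonpos.2 (hx k)
  obtain ⟨j, hj⟩ := hedge k
  have hfe : f (e k) ≤ 0 := by simpa [hj] using hf j
  rw [map_smul, smul_eq_mul]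
  exact mul_nonpos_of_nonneg_of_nonpos (div_nonneg_of_nonpos hle (hneg k).le) hfe

theorem solid_eq_convexHull [Finite ι] [Nonempty ι] :
    S.solid = convexHull ℝ (range S.vertex) := by
  refine Subset.antisymm (fun x hx => by_contra fun hmem => ?_)
    (convexHull_min (range_subset_iff.2 S.vertex_mem_solid) S.convex_solid)
  obtain ⟨f, c, hlt, hc⟩ := geometric_hahn_banach_closed_point (convex_convexHull ℝ _)
    ((finite_range S.vertex).isClosed_convexHull ℝ) hmem
  obtain ⟨i, hi⟩ := Finite.exists_max fun i => f (S.vertex i)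
  have hvi := hlt _ (subset_convexHull ℝ _ (mem_range_self i))
  linarith [S.apply_le_of_forall_vertex_le hi hx]

theorem exists_supporting_functional {u : E} {i : ι} (hi : S.IsSilhouette u i) :
    ∃ N : E →L[ℝ] ℝ, N u = 0 ∧ ∀ x ∈ S.solid, x ≠ S.vertex i → N x < N (S.vertex i) := by
  obtain ⟨α, hα, hsum⟩ := exists_pos_weights_sum_mul_eq_zero hi.1 hi.2
  refine ⟨∑ k ∈ S.inc i, α k • S.form k, by simpa using hsum, fun x hx hne => ?_⟩
  simp only [sum_apply, smul_apply, smul_eq_mul]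
  obtain ⟨k, hk, hkx⟩ : ∃ k ∈ S.inc i, S.form k x ≠ S.bound k := by
    by_contra! h
    exact hne (S.eq_vertex_of_forall_form_eq h)
  refine Finset.sum_lt_sum (fun l hl => ?_) ⟨k, hk, ?_⟩
  · rw [S.form_eq i l hl]
    exact mul_le_mul_of_nonneg_left (hx l) (hα l).le
  · rw [S.form_eq i k hk]
    exact mul_lt_mul_of_pos_left ((hx k).lt_of_ne hkx) (hα k)

variable {u : E} {π : E →L[ℝ] F}

theorem image_vertex_mem_extremePoints (hπ : π.ker = ℝ ∙ u) {i : ι} (hi : S.IsSilhouette u i) :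
    π (S.vertex i) ∈ extremePoints ℝ (π '' S.solid) := by
  obtain ⟨N, hNu, hN⟩ := S.exists_supporting_functional hi
  refine ⟨mem_image_of_mem π (S.vertex_mem_solid i), ?_⟩
  rintro _ ⟨x, hx, rfl⟩ _ ⟨y, hy, rfl⟩ ⟨a, b, ha, hb, hab, hxy⟩
  have hker : a • x + b • y - S.vertex i ∈ π.ker := by simp [hxy]
  obtain ⟨r, hr⟩ := Submodule.mem_span_singleton.1 (hπ ▸ hker)
  have hNxy : a * N x + b * N y = a * N (S.vertex i) + b * N (S.vertex i) := by
    have := congrArg N hr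
    simp only [map_smul, map_sub, map_add, hNu, smul_eq_mul, mul_zero] at this
    rw [← add_mul, hab]
    linarith
  have hle : ∀ z ∈ S.solid, N z ≤ N (S.vertex i) := fun z hz => by
    rcases eq_or_ne z (S.vertex i) with rfl | h
    exacts [le_rfl, (hN z hz h).le]
  by_contra hne
  have hxi := hN x hx fun h => hne (by rw [h])
  linarith [mul_lt_mul_of_pos_left hxi ha, mul_le_mul_of_nonneg_left (hle y hy) hb.le]

theorem extremePoints_image [Finite κ] [Finite ι] [Nonempty ι] (hπ0 : π ≠ 0)
    (hπ : π.ker = ℝ ∙ u) (hu : ∀ k, S.form k u ≠ 0) :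
    extremePoints ℝ (π '' S.solid) = (fun i => π (S.vertex i)) '' {i | S.IsSilhouette u i} := by
  refine Subset.antisymm (fun z hz => ?_)
    (image_subset_iff.2 fun i hi => S.image_vertex_mem_extremePoints hπ hi)
  obtain ⟨x, hx, rfl⟩ : z ∈ π '' range S.vertex := by
    refine extremePoints_convexHull_subset (𝕜 := ℝ) ?_
    rwa [← ContinuousLinearMap.coe_coe, ← LinearMap.image_convexHull, ← S.solid_eq_convexHull]
  obtain ⟨i, rfl⟩ := hx
  refine ⟨i, by_contra fun hi => ?_, rfl⟩
  obtain ⟨r, hr⟩ := S.exists_forall_form_add_smul_lt hu hi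
  have hπu : π u = 0 := by
    have : u ∈ π.ker := hπ ▸ Submodule.mem_span_singleton_self u
    exact this
  exact S.image_notMem_extremePoints hπ0 hr (by simpa [hπu] using hz)

theorem ncard_extremePoints_image [Finite κ] [Finite ι] [Nonempty ι] (hπ0 : π ≠ 0)
    (hπ : π.ker = ℝ ∙ u) (hu : ∀ k, S.form k u ≠ 0) :
    (extremePoints ℝ (π '' S.solid)).ncard = {i | S.IsSilhouette u i}.ncard := by
  rw [S.extremePoints_image hπ0 hπ hu]
  refine InjOn.ncard_image fun i hi j _ hij => by_contra fun hne => ?_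
  obtain ⟨N, hNu, hN⟩ := S.exists_supporting_functional hi
  have hker : S.vertex j - S.vertex i ∈ π.ker := by simpa [sub_eq_zero] using hij.symm
  obtain ⟨r, hr⟩ := Submodule.mem_span_singleton.1 (hπ ▸ hker)
  have := congrArg N hr
  rw [map_smul, hNu, smul_zero, map_sub] at this
  linarith [hN _ (S.vertex_mem_solid j) (S.vertex_injective.ne (Ne.symm hne))]

end FiniteDimensional

theorem symm_linear_apply_apply (ψ : E ≃ᵃ[ℝ] F) (x : E) :
    ψ.symm.linear (ψ x) = x - ψ.symm 0 := by
  simpa using congrFun ψ.symm.toAffineMap.decomp' (ψ x)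

/-- The image of a simple polytope under an affine isomorphism. -/
noncomputable def map [FiniteDimensional ℝ F] (S : SimplePolytope κ ι E) (ψ : E ≃ᵃ[ℝ] F) :
    SimplePolytope κ ι F :=
  have hform : ∀ k x, S.form k (ψ.symm.linear (ψ x)) = S.form k x - S.form k (ψ.symm 0) :=
    fun k x => by rw [symm_linear_apply_apply, map_sub]
  { form := fun k => LinearMap.toContinuousLinearMap ((S.form k : E →ₗ[ℝ] ℝ) ∘ₗ ψ.symm.linear)
    bound := fun k => S.bound k - S.form k (ψ.symm 0)
    vertex := fun i => ψ (S.vertex i)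
    inc := S.inc
    form_eq := fun i k hk => (hform k _).trans (by rw [S.form_eq i k hk])
    form_lt := fun i k hk => (hform k _).trans_lt (sub_lt_sub_right (S.form_lt i k hk) _)
    card_inc := fun i => (S.card_inc i).trans ψ.linear.finrank_eq
    inc_injective := S.inc_injective
    exists_mem_inc := S.exists_mem_inc
    exists_adjacent := S.exists_adjacent }

theorem solid_map [FiniteDimensional ℝ F] (S : SimplePolytope κ ι E) (ψ : E ≃ᵃ[ℝ] F) :
    (S.map ψ).solid = ψ '' S.solid := by
  refine Set.ext fun y => ?_
  obtain ⟨x, rfl⟩ := ψ.surjective y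
  rw [ψ.injective.mem_set_image]
  refine forall_congr' fun k => ?_
  change S.form k (ψ.symm.linear (ψ x)) ≤ S.bound k - S.form k (ψ.symm 0) ↔ _
  rw [symm_linear_apply_apply, map_sub, sub_le_sub_iff_right]

section E3

variable (S : SimplePolytope κ ι E3)

theorem isConvexPolyhedron_solid [Finite κ] [Finite ι] [Nonempty ι] :
    IsConvexPolyhedron S.solid := by
  have := Fintype.ofFinite κ
  refine ⟨?_, ?_, S.interior_solid_nonempty⟩
  · let H : κ → HalfSpace := fun k =>
      ⟨(InnerProductSpace.toDual ℝ E3).symm (S.form k), S.bound k, by simpa using S.form_ne_zero k⟩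
    refine ⟨Fintype.card κ, H ∘ (Fintype.equivFin κ).symm, ?_⟩
    simp only [Function.comp_apply, (Fintype.equivFin κ).symm.surjective.iInter_comp fun k =>
      (H k).carrier]
    ext x
    simp [solid, H, HalfSpace.carrier]
  · rw [S.solid_eq_convexHull, isBounded_convexHull]
    exact (finite_range _).isBounded

theorem isFace_facet [Finite κ] [Finite ι] (k : κ) : IsFace S.solid (S.facet k) := by
  refine ⟨S.isExposed_facet k, ?_⟩
  have h := Module.Dual.finrank_ker_add_one_of_ne_zero (f := (S.form k : E3 →ₗ[ℝ] ℝ))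
    (by exact_mod_cast S.form_ne_zero k)
  rw [S.vectorSpan_facet]
  simpa using h

theorem shadow_solid_eq_convexHull [Finite ι] [Nonempty ι] (u : E3) :
    shadow u S.solid = convexHull ℝ ((ℝ ∙ u)ᗮ.starProjection '' range S.vertex) := by
  rw [shadow, S.solid_eq_convexHull, ← ContinuousLinearMap.coe_coe, LinearMap.image_convexHull]

theorem vectorSpan_shadow_solid [Finite κ] [Finite ι] [Nonempty ι] (u : E3) :
    vectorSpan ℝ (shadow u S.solid) = (ℝ ∙ u)ᗮ := by
  have h := AffineMap.map_vectorSpan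
    (f := (ℝ ∙ u)ᗮ.starProjection.toLinearMap.toAffineMap) (s := S.solid)
  rw [S.vectorSpan_solid, Submodule.map_top] at h
  exact h.symm.trans (Submodule.range_starProjection _)

theorem isEquiprojective [Finite κ] [Finite ι] [Nonempty ι] {n : ℕ}
    (h : ∀ u, (∀ k, S.form k u ≠ 0) → {i | S.IsSilhouette u i}.ncard = n) :
    IsEquiprojective n S.solid := by
  refine ⟨S.isConvexPolyhedron_solid, fun u hu hface => ?_⟩
  have hform : ∀ k, S.form k u ≠ 0 := fun k hk =>
    hface _ (S.isFace_facet k) (by rw [S.vectorSpan_facet]; exact hk)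
  have hrank : finrank ℝ (ℝ ∙ u)ᗮ = 2 :=
    have : Fact (finrank ℝ E3 = 2 + 1) := ⟨by simp⟩
    Submodule.finrank_orthogonal_span_singleton hu
  refine ⟨⟨((finite_range S.vertex).image (ℝ ∙ u)ᗮ.starProjection).toFinset, ?_⟩, ?_, ?_⟩
  · rw [Finite.coe_toFinset, S.shadow_solid_eq_convexHull]
  · rw [S.vectorSpan_shadow_solid, hrank]
  · rw [← h u hform]
    refine S.ncard_extremePoints_image (fun h0 => ?_) ?_ hform
    · have hbot : (ℝ ∙ u)ᗮ = ⊥ := (Submodule.range_starProjection _).symm.trans (by simp [h0])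
      rw [hbot, finrank_bot] at hrank
      omega
    · rw [Submodule.ker_starProjection, Submodule.orthogonal_orthogonal]

end E3

end SimplePolytope

/-! ### Counting sign changes -/

/-- `1` if the real numbers `a` and `b` have opposite signs, else `0`. -/
noncomputable def separated (a b : ℝ) : ℕ := if a * b < 0 then 1 else 0

theorem separated_comm (a b : ℝ) : separated a b = separated b a := by
  simp only [separated, mul_comm]

theorem separated_add_separated_neg {a b : ℝ} (ha : a ≠ 0) (hb : b ≠ 0) :
    separated a b + separated a (-b) = 1 := by
  simp only [separated, mul_neg, neg_lt_zero]
  rcases (mul_ne_zero ha hb).lt_or_gt with h | h <;> simp [h, h.le]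

theorem separated_add_separated_of_between {r a b c : ℝ} (hr : 0 < r) (hc : c ≠ 0)
    (h : r * c = a + b) : separated a c + separated c b = separated a b := by
  simp only [separated, mul_neg_iff]
  rcases hc.lt_or_gt with hc | hc <;> rcases lt_trichotomy a 0 with ha | ha | ha <;>
    rcases lt_trichotomy b 0 with hb | hb | hb <;>
    simp [ha, hb, hc, ha.not_gt, hb.not_gt, hc.not_gt] <;> nlinarith

theorem two_mul_ite_both_signs {a : Fin 3 → ℝ} (ha : ∀ k, a k ≠ 0) :
    2 * (if (∃ k, 0 < a k) ∧ ∃ k, a k < 0 then 1 else 0) =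
      separated (a 0) (a 1) + separated (a 0) (a 2) + separated (a 1) (a 2) := by
  simp only [Fin.exists_fin_succ, separated, mul_neg_iff]
  rcases (ha 0).lt_or_gt with h0 | h0 <;> rcases (ha 1).lt_or_gt with h1 | h1 <;>
    rcases (ha 2).lt_or_gt with h2 | h2 <;> simp [h0, h1, h2, h0.not_gt, h1.not_gt, h2.not_gt]

/-! ### The truncated cupola in model coordinates -/

/-- The facet forms of the model of the equitruncated cupola: the side faces of the cupola are
`0, …, 5`, with `3` for `t₁`, its base is `6`, and `7`, …, `11` are made by cut1, the two planes of
cut2, cut3 and cut4. -/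
noncomputable def facetForm : Fin 12 → E3 →L[ℝ] ℝ :=
  let x : E3 →L[ℝ] ℝ := EuclideanSpace.proj 0
  let y : E3 →L[ℝ] ℝ := EuclideanSpace.proj 1
  let z : E3 →L[ℝ] ℝ := EuclideanSpace.proj 2
  ![x, y, z, y + z - x, x + y - z, x - y + z, -(x + y + z), x - y - z, y - z, z - y, x + y + z,
    y + z]

/-- The reflection symmetry of the model cupola. -/
noncomputable def mirror (p : E3) : E3 := !₂[p 0, p 2, p 1]

/-- The action of the symmetry `mirror` on the facets. -/
def mirrorFacet : Fin 12 → Fin 12 := ![0, 2, 1, 3, 5, 4, 6, 7, 9, 8, 10, 11]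

/-- The three facets through each of the vertices of the truncated cupola on one side of its plane
of symmetry. -/
def halfVertexFacet : Fin 10 → Fin 3 → Fin 12 :=
  ![![1, 4, 8], ![1, 4, 10], ![1, 10, 11], ![1, 3, 11], ![1, 3, 6],
    ![1, 6, 8], ![0, 4, 10], ![0, 4, 7], ![4, 6, 7], ![4, 6, 8]]

/-- The three facets through each vertex of the truncated cupola; the vertices `(true, i)` are the
mirror images of the vertices `(false, i)`. -/
def vertexFacet : Bool × Fin 10 → Fin 3 → Fin 12
  | (false, i) => halfVertexFacet i
  | (true, i) => mirrorFacet ∘ halfVertexFacet i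

theorem mirrorFacet_mirrorFacet : ∀ k, mirrorFacet (mirrorFacet k) = k := by decide

theorem facetForm_mirrorFacet (k : Fin 12) (p : E3) :
    facetForm (mirrorFacet k) p = facetForm k (mirror p) := by
  fin_cases k <;> simp [facetForm, mirrorFacet, mirror] <;> ring

theorem mirror_mirror (p : E3) : mirror (mirror p) = p := by
  ext i
  fin_cases i <;> rfl

theorem facetForm_apply (k : Fin 12) (p : E3) :
    facetForm k p = ![p 0, p 1, p 2, p 1 + p 2 - p 0, p 0 + p 1 - p 2, p 0 - p 1 + p 2,
      -(p 0 + p 1 + p 2), p 0 - p 1 - p 2, p 1 - p 2, p 2 - p 1, p 0 + p 1 + p 2, p 1 + p 2] k := by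
  fin_cases k <;> simp [facetForm]

theorem card_image_vertexFacet : ∀ i, (Finset.univ.image (vertexFacet i)).card = 3 := by
  decide

/-- The number of silhouette edges at a vertex with three facets is the number of sign changes
between the three facet normals, which is `0` or `2`. -/
noncomputable def signChanges (u : E3) (facets : Fin 3 → Fin 12) : ℕ :=
  separated (facetForm (facets 0) u) (facetForm (facets 1) u) +
  separated (facetForm (facets 0) u) (facetForm (facets 2) u) +
  separated (facetForm (facets 1) u) (facetForm (facets 2) u)

theorem signChanges_mirrorFacet_comp (u : E3) (facets : Fin 3 → Fin 12) :
    signChanges u (mirrorFacet ∘ facets) = signChanges (mirror u) facets := by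
  simp only [signChanges, Function.comp_apply, facetForm_mirrorFacet]

theorem sum_signChanges_halfVertexFacet {u : E3} (hu : ∀ k, facetForm k u ≠ 0) :
    ∑ i, signChanges u (halfVertexFacet i) =
      8 + 2 * (separated (facetForm 0 u) (facetForm 8 u) +
        separated (facetForm 6 u) (facetForm 8 u) +
        separated (facetForm 11 u) (facetForm 8 u)) := by
  have between : ∀ {r : ℝ} (i j k : Fin 12), 0 < r →
      r * facetForm j u = facetForm i u + facetForm k u →
      separated (facetForm i u) (facetForm j u) + separated (facetForm j u) (facetForm k u) =
        separated (facetForm i u) (facetForm k u) :=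
    fun i j k hr h => separated_add_separated_of_between hr (hu j) h
  have opposite : ∀ (i : Fin 12) {j k : Fin 12}, facetForm k u = -facetForm j u →
      separated (facetForm i u) (facetForm j u) + separated (facetForm i u) (facetForm k u) = 1 :=
    fun i j k h => h ▸ separated_add_separated_neg (hu i) (hu j)
  have h6 : facetForm 6 u = -facetForm 10 u := by simp [facetForm]
  have h7 : facetForm 7 u = -facetForm 3 u := by simp [facetForm]; ring
  have h1_10_6 := opposite 1 h6
  have h4_10_6 := opposite 4 h6
  have h0_3_7 := opposite 0 h7
  have h4_3_7 := opposite 4 h7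
  have h6_3_7 := opposite 6 h7
  have h4_1_3 := between 4 1 3 two_pos (by simp [facetForm]; ring)
  have h8_1_11 := between 8 1 11 two_pos (by simp [facetForm]; ring)
  have h0_4_8 := between 0 4 8 one_pos (by simp [facetForm]; ring)
  have h0_10_11 := between 0 10 11 one_pos (by simp [facetForm]; ring)
  have h3_11_0 := between 3 11 0 one_pos (by simp [facetForm])
  have comm := fun i j => separated_comm (facetForm i u) (facetForm j u)
  rw [comm 4 1] at h4_1_3
  rw [comm 8 1, comm 8 11] at h8_1_11
  rw [comm 11 0, comm 3 0] at h3_11_0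
  rw [comm 6 3] at h6_3_7
  simp only [Fin.sum_univ_succ, Fin.sum_univ_zero, signChanges, halfVertexFacet, Fin.reduceSucc,
    Fin.succ_zero_eq_one, Fin.succ_one_eq_two, Matrix.cons_val]
  omega

theorem sum_signChanges_vertexFacet {u : E3} (hu : ∀ k, facetForm k u ≠ 0) :
    ∑ i, signChanges u (vertexFacet i) = 22 := by
  have hu' : ∀ k, facetForm k (mirror u) ≠ 0 := fun k => by
    rw [← facetForm_mirrorFacet]; exact hu _
  have h9 : facetForm 9 u = -facetForm 8 u := by simp [facetForm]
  have h : ∀ i, separated (facetForm i u) (facetForm 8 u) +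
      separated (facetForm i u) (facetForm 9 u) = 1 := fun i =>
    h9 ▸ separated_add_separated_neg (hu i) (hu 8)
  have h0 := h 0
  have h6 := h 6
  have h11 := h 11
  simp only [Fintype.sum_prod_type, Fintype.sum_bool, vertexFacet, signChanges_mirrorFacet_comp,
    sum_signChanges_halfVertexFacet hu, sum_signChanges_halfVertexFacet hu']
  simp only [← facetForm_mirrorFacet, mirrorFacet, Matrix.cons_val]
  omega

/-- The offsets of the planes of the five cuts in model coordinates. -/
structure CutOffsets where
  cut1 : ℝ
  cut2 : ℝ
  cut2' : ℝ
  cut3 : ℝ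
  cut4 : ℝ

namespace CutOffsets

/-- The cuts are in the position described in the theorem: they cross the prescribed edges, their
sections of the cupola do not run into one another, and the section of cut4 has its vertices on
the edges that cut3 leaves at the corner `a 0`. -/
structure Admissible (o : CutOffsets) : Prop where
  one_lt_cut2 : 1 < o.cut2
  cut2_lt : o.cut2 < 2
  one_lt_cut2' : 1 < o.cut2'
  cut2'_lt : o.cut2' < 2
  cut1_lt : o.cut1 < 2
  cut3_lt : o.cut3 < 2
  cut2_cut1 : 2 * (2 - o.cut2) < o.cut1
  cut2'_cut1 : 2 * (2 - o.cut2') < o.cut1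
  cut2_cut3 : 2 * (2 - o.cut2) < o.cut3
  cut2'_cut3 : 2 * (2 - o.cut2') < o.cut3
  cut1_cut3 : 2 < o.cut1 + o.cut3
  one_lt_cut4 : 1 < o.cut4
  cut4_lt : o.cut4 < 1 + o.cut3 / 2

/-- The offsets of the mirror image. -/
def mirror (o : CutOffsets) : CutOffsets := ⟨o.cut1, o.cut2', o.cut2, o.cut3, o.cut4⟩

variable (o : CutOffsets)

/-- The right-hand sides of the facet inequalities of the truncated cupola. -/
def facetBound : Fin 12 → ℝ :=
  ![1, 1, 1, 2, 2, 2, 0, o.cut1, o.cut2, o.cut2', o.cut3, o.cut4]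

/-- The vertices of the truncated cupola listed in `halfVertexFacet`. -/
noncomputable def halfVertex : Fin 10 → E3 :=
  let ⟨c, d, _, e, f⟩ := o
  ![!₂[2 - d, 1, 1 - d], !₂[e / 2, 1, e / 2 - 1], !₂[e - f, 1, f - 1], !₂[f - 2, 1, f - 1],
    !₂[-1, 1, 0], !₂[d - 2, 1, 1 - d], !₂[1, e / 2, e / 2 - 1], !₂[1, 1 - c / 2, -(c / 2)],
    !₂[c / 2, 1 - c / 2, -1], !₂[2 - d, d - 1, -1]]

/-- The vertices of the truncated cupola. -/
noncomputable def vertex : Bool × Fin 10 → E3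
  | (false, i) => o.halfVertex i
  | (true, i) => _root_.mirror (o.mirror.halfVertex i)

theorem facetForm_halfVertex (i : Fin 10) (k : Fin 3) :
    facetForm (halfVertexFacet i k) (o.halfVertex i) = o.facetBound (halfVertexFacet i k) := by
  fin_cases i <;> fin_cases k <;> simp [facetForm, halfVertexFacet, halfVertex, facetBound] <;> ring

variable {o}

theorem Admissible.facetForm_halfVertex_lt (ho : o.Admissible) (i : Fin 10) (k : Fin 12)
    (hk : ∀ j, halfVertexFacet i j ≠ k) : facetForm k (o.halfVertex i) < o.facetBound k := by
  obtain ⟨⟩ := ho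
  revert k
  simp only [facetForm_apply]
  fin_cases i <;>
    simp only [Fin.forall_fin_succ, halfVertexFacet, halfVertex, facetBound,
      Fin.reduceSucc, Fin.succ_zero_eq_one, Fin.succ_one_eq_two, Matrix.cons_val, Fin.zero_eta,
      Fin.reduceFinMk, Fin.mk_one, Fin.reduceEq, ne_eq, not_true_eq_false, not_false_eq_true,
      PiLp.toLp_apply, Fin.isValue, and_false, and_true, true_and, forall_const,
      IsEmpty.forall_iff, zero_ne_one, one_ne_zero] <;>
    and_intros <;> linarith

theorem facetBound_mirrorFacet (o : CutOffsets) (k : Fin 12) :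
    o.facetBound (mirrorFacet k) = o.mirror.facetBound k := by
  fin_cases k <;> simp [facetBound, mirrorFacet, mirror]

theorem facetForm_vertex (i : Bool × Fin 10) (k : Fin 3) :
    facetForm (vertexFacet i k) (o.vertex i) = o.facetBound (vertexFacet i k) := by
  obtain ⟨_ | _, i⟩ := i
  · exact o.facetForm_halfVertex i k
  · simp only [vertexFacet, vertex, Function.comp_apply, facetForm_mirrorFacet, mirror_mirror,
      facetBound_mirrorFacet, facetForm_halfVertex]

theorem Admissible.mirror (ho : o.Admissible) : o.mirror.Admissible where
  one_lt_cut2 := ho.one_lt_cut2'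
  cut2_lt := ho.cut2'_lt
  one_lt_cut2' := ho.one_lt_cut2
  cut2'_lt := ho.cut2_lt
  cut1_lt := ho.cut1_lt
  cut3_lt := ho.cut3_lt
  cut2_cut1 := ho.cut2'_cut1
  cut2'_cut1 := ho.cut2_cut1
  cut2_cut3 := ho.cut2'_cut3
  cut2'_cut3 := ho.cut2_cut3
  cut1_cut3 := ho.cut1_cut3
  one_lt_cut4 := ho.one_lt_cut4
  cut4_lt := ho.cut4_lt

theorem Admissible.facetForm_vertex_lt (ho : o.Admissible) (i : Bool × Fin 10) (k : Fin 12)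
    (hk : ∀ j, vertexFacet i j ≠ k) : facetForm k (o.vertex i) < o.facetBound k := by
  obtain ⟨_ | _, i⟩ := i
  · exact ho.facetForm_halfVertex_lt i k hk
  · have hk' : ∀ j, halfVertexFacet i j ≠ mirrorFacet k := fun j hj =>
      hk j (by simp only [vertexFacet, Function.comp_apply, hj, mirrorFacet_mirrorFacet])
    have h := ho.mirror.facetForm_halfVertex_lt i (mirrorFacet k) hk'
    rwa [facetForm_mirrorFacet, ← facetBound_mirrorFacet, mirrorFacet_mirrorFacet] at h

/-- The truncated cupola in model coordinates. -/
noncomputable def Admissible.polytope (ho : o.Admissible) :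
    SimplePolytope (Fin 12) (Bool × Fin 10) E3 where
  form := facetForm
  bound := o.facetBound
  vertex := o.vertex
  inc i := Finset.univ.image (vertexFacet i)
  form_eq i := by simpa using o.facetForm_vertex i
  form_lt i k hk := ho.facetForm_vertex_lt i k (by simpa using hk)
  card_inc i := by simpa using card_image_vertexFacet i
  inc_injective := by decide
  exists_mem_inc := by decide
  exists_adjacent := by decide

theorem Admissible.ncard_isSilhouette (ho : o.Admissible) {u : E3}
    (hu : ∀ k, facetForm k u ≠ 0) : {i | ho.polytope.IsSilhouette u i}.ncard = 11 := by
  classical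
  have hvertex : ∀ i, 2 * (if ho.polytope.IsSilhouette u i then 1 else 0) =
      signChanges u (vertexFacet i) := fun i => by
    simpa [SimplePolytope.IsSilhouette, polytope, signChanges] using
      two_mul_ite_both_signs (a := fun k => facetForm (vertexFacet i k) u) fun k => hu _
  have hcard : 2 * (Finset.univ.filter (ho.polytope.IsSilhouette u)).card = 22 := by
    simp only [Finset.card_filter, Finset.mul_sum, hvertex, sum_signChanges_vertexFacet hu]
  rw [← Finset.coe_filter_univ, Set.ncard_coe_finset]
  omega

end CutOffsets

/-! ### The facets of the cupola -/

/-- The cupola in model coordinates, given by its eight facets. -/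
def modelCupola : Set E3 :=
  ⋂ k : Fin 8, {p | facetForm (![0, 1, 2, 3, 4, 5, 6, 10] k) p ≤ ![1, 1, 1, 2, 2, 2, 0, 2] k}

theorem mem_modelCupola {p : E3} :
    p ∈ modelCupola ↔ p 0 ≤ 1 ∧ p 1 ≤ 1 ∧ p 2 ≤ 1 ∧ p 1 + p 2 - p 0 ≤ 2 ∧ p 0 + p 1 - p 2 ≤ 2 ∧
      p 0 - p 1 + p 2 ≤ 2 ∧ -(p 0 + p 1 + p 2) ≤ 0 ∧ p 0 + p 1 + p 2 ≤ 2 := by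
  simp only [modelCupola, mem_iInter, mem_ofPred_eq, facetForm_apply, Fin.forall_fin_succ,
    Fin.forall_fin_zero, Fin.reduceSucc, Fin.succ_zero_eq_one, Fin.succ_one_eq_two,
    Matrix.cons_val, and_true]

theorem convex_modelCupola : Convex ℝ modelCupola :=
  convex_iInter fun _ => convex_halfSpace_le (facetForm _).isLinear _

section Convex

variable {E : Type*} [AddCommGroup E] [Module ℝ E] {K : Set E}

theorem mem_of_eq_three_smul (hK : Convex ℝ K) {u v w p : E} (hu : u ∈ K) (hv : v ∈ K)
    (hw : w ∈ K) {a b c : ℝ} (ha : 0 ≤ a) (hb : 0 ≤ b) (hc : 0 ≤ c) (habc : a + b + c = 1)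
    (hp : p = a • u + b • v + c • w) : p ∈ K := by
  have h := hK.sum_mem (t := Finset.univ) (w := ![a, b, c]) (z := ![u, v, w])
    (by simp [Fin.forall_fin_succ, *]) (by simpa [Fin.sum_univ_three])
    (by simp [Fin.forall_fin_succ, *])
  simpa [Fin.sum_univ_three, hp] using h

theorem mem_of_add_smul_mem_of_add_smul_mem (hK : Convex ℝ K) {p w : E} {a b : ℝ} (ha : a ≤ 0)
    (hb : 0 ≤ b) (hpa : p + a • w ∈ K) (hpb : p + b • w ∈ K) : p ∈ K := by
  have h := (hK.affine_preimage (AffineMap.lineMap p (p + w))).ordConnected.out (x := a) (y := b)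
    (by simpa [AffineMap.lineMap_apply, add_comm] using hpa)
    (by simpa [AffineMap.lineMap_apply, add_comm] using hpb) ⟨ha, hb⟩
  simpa using h

end Convex

theorem isLinearMap_mirror : IsLinearMap ℝ mirror where
  map_add p q := by ext i; fin_cases i <;> rfl
  map_smul r p := by ext i; fin_cases i <;> rfl

theorem mirror_cupolaTop (i : Fin 3) : mirror (cupolaTop i) = cupolaTop (-i) := by
  ext j
  fin_cases i <;> fin_cases j <;> rfl

theorem mirror_cupolaBase (i : Fin 6) : mirror (cupolaBase i) = cupolaBase (1 - i) := by
  ext j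
  fin_cases i <;> fin_cases j <;> rfl

theorem upper_mem_of_vertex_mem {K : Set E3} (hK : Convex ℝ K) (ha : ∀ i, i ≠ 0 → cupolaTop i ∈ K)
    (hb : ∀ i, cupolaBase i ∈ K) {x s : ℝ} (h0 : cupolaTop 0 ∈ K ∨ s ≤ 1) (hx : x ≤ 1)
    (hsx : s - x ≤ 2) (hxs : 0 ≤ x + s) (hxs' : x + s ≤ 2) :
    !₂[x, (s + (2 - max x s)) / 2, (s - (2 - max x s)) / 2] ∈ K := by
  have ha2 := ha 2 (by decide)
  rcases le_total s x with h | h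
  · rw [max_eq_left h]
    refine mem_of_eq_three_smul hK (hb 2) ha2 (hb 1) (a := 1 - x) (b := (x + s) / 2)
      (c := (x - s) / 2) (by linarith) (by linarith) (by linarith) (by ring) ?_
    ext i
    fin_cases i <;> simp [cupolaBase, cupolaTop] <;> ring
  rw [max_eq_right h]
  by_cases hs : s ≤ 1
  · refine mem_of_eq_three_smul hK (hb 2) ha2 (hb 3) (a := 1 - s) (b := (x + s) / 2)
      (c := (s - x) / 2) (by linarith) (by linarith) (by linarith) (by ring) ?_
    ext i
    fin_cases i <;> simp [cupolaBase, cupolaTop] <;> ring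
  · refine mem_of_eq_three_smul hK (h0.resolve_right hs) ha2 (hb 3) (a := s - 1)
      (b := 1 - (s - x) / 2) (c := 1 - (x + s) / 2) (by linarith) (by linarith) (by linarith)
      (by ring) ?_
    ext i
    fin_cases i <;> simp [cupolaBase, cupolaTop] <;> ring

theorem mem_of_mem_modelCupola {K : Set E3} (hK : Convex ℝ K) (ha : ∀ i, i ≠ 0 → cupolaTop i ∈ K)
    (hb : ∀ i, cupolaBase i ∈ K) {p : E3} (h0 : cupolaTop 0 ∈ K ∨ p 1 + p 2 ≤ 1)
    (hp : p ∈ modelCupola) : p ∈ K := by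
  obtain ⟨hx, hy, hz, hyz, hxy, hxz, hsum, hsum'⟩ := mem_modelCupola.mp hp
  obtain ⟨m, hm⟩ : ∃ m, 2 - max (p 0) (p 1 + p 2) = m := ⟨_, rfl⟩
  have hm_lower : -m ≤ p 1 - p 2 := by
    rw [← hm, neg_sub, sub_le_iff_le_add, max_le_iff]
    constructor <;> linarith
  have hm_upper : p 1 - p 2 ≤ m := by
    rw [← hm, le_sub_comm, max_le_iff]
    constructor <;> linarith
  have hupper := upper_mem_of_vertex_mem hK ha hb h0 hx hyz (by linarith) (by linarith)
  rw [hm] at hupper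
  have hlower := upper_mem_of_vertex_mem (hK.is_linear_preimage isLinearMap_mirror)
    (fun i hi => by simpa [mirror_cupolaTop] using ha (-i) (neg_ne_zero.mpr hi))
    (fun i => by simpa [mirror_cupolaBase] using hb (1 - i))
    (h0.imp_left fun h => by simpa [mirror_cupolaTop] using h) hx hyz (by linarith) (by linarith)
  rw [hm] at hlower
  refine mem_of_add_smul_mem_of_add_smul_mem hK (w := !₂[0, 1 / 2, -1 / 2])
    (a := -m - (p 1 - p 2)) (b := m - (p 1 - p 2)) (by linarith) (by linarith) ?_ ?_
  · convert! (show mirror _ ∈ K from hlower) using 1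
    ext i
    fin_cases i <;> simp [mirror] <;> ring
  · convert hupper using 1
    ext i
    fin_cases i <;> simp <;> ring

theorem modelCupola_eq_convexHull :
    modelCupola = convexHull ℝ (range cupolaTop ∪ range cupolaBase) := by
  refine Subset.antisymm (fun p hp => ?_) (convexHull_min ?_ convex_modelCupola)
  · have hmem := subset_convexHull ℝ (range cupolaTop ∪ range cupolaBase)
    exact mem_of_mem_modelCupola (convex_convexHull ℝ _) (fun i _ => hmem (.inl ⟨i, rfl⟩))
      (fun i => hmem (.inr ⟨i, rfl⟩)) (.inl (hmem (.inl ⟨0, rfl⟩))) hp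
  · rintro _ (⟨i, rfl⟩ | ⟨i, rfl⟩) <;> fin_cases i <;>
      simp [mem_modelCupola, cupolaTop, cupolaBase] <;> norm_num

/-! ### Parallelogram sections -/

section Parallelogram

variable {E : Type*} [AddCommGroup E] [Module ℝ E]

/-- The parallelogram with corner `p` and sides `v`, `w`. -/
def parallelogram (p v w : E) : Set E :=
  {x | ∃ s t : ℝ, 0 ≤ s ∧ s ≤ 1 ∧ 0 ≤ t ∧ t ≤ 1 ∧ x = p + s • v + t • w}

theorem add_smul_add_smul_mem_parallelogram_iff {p v w : E} (h : LinearIndependent ℝ ![v, w])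
    {s t : ℝ} : p + s • v + t • w ∈ parallelogram p v w ↔ s ∈ Icc 0 1 ∧ t ∈ Icc 0 1 := by
  refine ⟨?_, fun ⟨hs, ht⟩ => ⟨s, t, hs.1, hs.2, ht.1, ht.2, rfl⟩⟩
  rintro ⟨s', t', hs, hs', ht, ht', heq⟩
  rw [add_assoc, add_assoc, add_right_inj] at heq
  obtain ⟨rfl, rfl⟩ := h.eq_of_pair heq
  exact ⟨⟨hs, hs'⟩, ht, ht'⟩

theorem parallelogram_comm (p v w : E) : parallelogram p v w = parallelogram p w v := by
  ext x
  constructor <;> rintro ⟨s, t, hs, hs', ht, ht', rfl⟩ <;>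
    exact ⟨t, s, ht, ht', hs, hs', add_right_comm _ _ _⟩

theorem parallelogram_add_neg (p v w : E) :
    parallelogram (p + v) (-v) w = parallelogram p v w := by
  ext x
  constructor <;> rintro ⟨s, t, hs, hs', ht, ht', rfl⟩ <;>
    exact ⟨1 - s, t, by linarith, by linarith, ht, ht', by module⟩

variable [TopologicalSpace E] {ι : Type*} [Finite ι]
  {f : ι → E →L[ℝ] ℝ} {b : ι → ℝ} {g : E →L[ℝ] ℝ} {c : ℝ} {p v w : E}

theorem exists_tight_of_notMem {x u : E} (hx : ∀ k, f k x ≤ b k)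
    (hu : ∀ r > (0 : ℝ), ¬∀ k, f k (x - r • u) ≤ b k) : ∃ k, f k x = b k ∧ f k u < 0 := by
  by_contra! h
  have hnear (k : ι) : ∀ᶠ r : ℝ in 𝓝[>] 0, f k (x - r • u) ≤ b k := by
    rcases (hx k).eq_or_lt with hk | hk
    · filter_upwards [self_mem_nhdsWithin] with r (hr : 0 < r)
      rw [map_sub, map_smul, hk, smul_eq_mul]
      exact sub_le_self _ (mul_nonneg hr.le (h k hk))
    · have hcont : Continuous fun r : ℝ => f k (x - r • u) := by
        simp only [map_sub, map_smul]
        fun_prop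
      filter_upwards [nhdsWithin_le_nhds (hcont.tendsto' 0 (f k x) (by simp) (Iio_mem_nhds hk))]
        with r hr using le_of_lt hr
  obtain ⟨r, hr, hr0⟩ := ((eventually_all.mpr hnear).and self_mem_nhdsWithin).exists
  exact hu r hr0 hr

theorem apply_eq_zero_of_parallelogram (hg : ∀ x ∈ parallelogram p v w, g x = c) : g v = 0 := by
  have hp := hg p ⟨0, 0, by simp⟩
  have hpv := hg (p + v) ⟨1, 0, by simp⟩
  rwa [map_add, hp, add_eq_left] at hpv

theorem exists_tight_along_side
    (hS : {x | (∀ k, f k x ≤ b k) ∧ g x = c} = parallelogram p v w)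
    (hvw : LinearIndependent ℝ ![v, w]) : ∃ k, f k p = b k ∧ f k w = 0 ∧ f k v < 0 := by
  have hmem (x : E) : ((∀ k, f k x ≤ b k) ∧ g x = c) ↔ x ∈ parallelogram p v w := by
    rw [← hS, mem_ofPred_eq]
  have hgv : g v = 0 := apply_eq_zero_of_parallelogram fun x hx => ((hmem x).mpr hx).2
  have hmid : p + (2⁻¹ : ℝ) • w ∈ parallelogram p v w := ⟨0, 2⁻¹, by norm_num⟩
  obtain ⟨hmid_le, hgmid⟩ := (hmem _).mpr hmid
  obtain ⟨k, hk, hkv⟩ := exists_tight_of_notMem (u := v) hmid_le fun r hr hle => by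
    have hout : p + -r • v + (2⁻¹ : ℝ) • w ∈ parallelogram p v w := by
      convert (hmem (p + (2⁻¹ : ℝ) • w - r • v)).mp ⟨hle, by simp [hgv, ← hgmid]⟩ using 1
      module
    linarith [((add_smul_add_smul_mem_parallelogram_iff hvw).mp hout).1.1]
  have hp := ((hmem p).mpr ⟨0, 0, by simp⟩).1 k
  have hpw := ((hmem (p + w)).mpr ⟨0, 1, by simp⟩).1 k
  rw [map_add, map_smul, smul_eq_mul] at hk
  rw [map_add] at hpw
  exact ⟨k, by linarith, by linarith, hkv⟩

end Parallelogram

/-! ### The rectangular cut -/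

theorem apply_eq_zero_of_linearIndependent_pair {E : Type*} [AddCommGroup E] [Module ℝ E]
    (hE : finrank ℝ E = 3) {N g : E →ₗ[ℝ] ℝ} {u v w : E} (hN : N ≠ 0)
    (hvw : LinearIndependent ℝ ![v, w]) (hNv : N v = 0) (hNw : N w = 0) (hgv : g v = 0)
    (hgw : g w = 0) (hu : N u = 0) : g u = 0 := by
  have : FiniteDimensional ℝ E := .of_finrank_eq_succ hE
  have span_le {f : E →ₗ[ℝ] ℝ} (hfv : f v = 0) (hfw : f w = 0) :
      Submodule.span ℝ (range ![v, w]) ≤ f.ker := by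
    rw [Submodule.span_le, Matrix.range_cons_cons_empty]
    rintro _ (rfl | rfl)
    exacts [hfv, hfw]
  have hspan : Submodule.span ℝ (range ![v, w]) = N.ker :=
    Submodule.eq_of_le_of_finrank_eq (span_le hNv hNw) <| by
      have hker := Module.Dual.finrank_ker_add_one_of_ne_zero hN
      rw [finrank_span_eq_card hvw, Fintype.card_fin]
      omega
  exact span_le hgv hgw (hspan ▸ hu)

theorem facetForm_eleven_ne_zero : (facetForm 11 : E3 →ₗ[ℝ] ℝ) ≠ 0 := fun h => by
  simpa [facetForm_apply] using LinearMap.congr_fun h !₂[0, 1, 0]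

theorem smul_eq_of_facetForm_eq_zero {v : E3} {i j : Fin 12} (hi : i ∈ ({1, 2, 3, 10} : Set _))
    (hj : j ∈ ({1, 2, 3, 10} : Set _)) (hij : i ≠ j) (hvi : facetForm i v = 0)
    (hvj : facetForm j v = 0) :
    v 1 + v 2 = 0 ∨
      ∃ e ∈ ({cupolaTop 1, cupolaTop 2, cupolaBase 3, cupolaBase 4} : Set E3),
        v = (v 1 + v 2) • e := by
  wlog hlt : i < j generalizing i j
  · exact this hj hi hij.symm hvj hvi (hij.lt_or_gt.resolve_left hlt)
  obtain ⟨x, y, z, rfl⟩ : ∃ x y z : ℝ, v = !₂[x, y, z] :=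
    ⟨v 0, v 1, v 2, by ext i; fin_cases i <;> rfl⟩
  rw [facetForm_apply] at hvi hvj
  rcases hi with rfl | rfl | rfl | rfl <;> rcases hj with rfl | rfl | rfl | rfl <;>
    first
    | exact absurd hlt (by decide)
    | skip
  all_goals simp only [Matrix.cons_val] at hvi hvj
  · exact .inl (by simp [hvi, hvj])
  · exact .inr ⟨cupolaTop 1, by simp, by ext i; fin_cases i <;> simp [cupolaTop] <;> linarith⟩
  · exact .inr ⟨cupolaBase 4, by simp, by ext i; fin_cases i <;> simp [cupolaBase] <;> linarith⟩
  · exact .inr ⟨cupolaTop 2, by simp, by ext i; fin_cases i <;> simp [cupolaTop] <;> linarith⟩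
  · exact .inr ⟨cupolaBase 3, by simp, by ext i; fin_cases i <;> simp [cupolaBase] <;> linarith⟩
  · exact .inl (by simp; linarith)

namespace CutOffsets

variable {o : CutOffsets} {p : E3}

theorem forall_castSucc_facetForm_le_iff (h₃ : o.cut3 ≤ 2) :
    (∀ k : Fin 11, facetForm k.castSucc p ≤ o.facetBound k.castSucc) ↔
      p ∈ modelCupola ∧ facetForm 7 p ≤ o.cut1 ∧ facetForm 8 p ≤ o.cut2 ∧
        facetForm 9 p ≤ o.cut2' ∧ facetForm 10 p ≤ o.cut3 := by
  simp only [Fin.forall_fin_succ, Fin.reduceSucc, Fin.succ_zero_eq_one, Fin.succ_one_eq_two,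
    Fin.forall_fin_zero, Fin.reduceCastSucc, Fin.castSucc_zero, Fin.castSucc_one, and_true,
    mem_modelCupola, facetForm_apply, facetBound, Matrix.cons_val]
  grind

theorem mem_of_facetForm_eq (h₁ : 0 < o.cut1) (h₂ : 1 < o.cut2) (h₂' : 1 < o.cut2')
    (h₃ : o.cut3 < 2) (hp : ∀ k : Fin 11, facetForm k.castSucc p ≤ o.facetBound k.castSucc)
    (hs : 1 < p 1 + p 2) {k : Fin 11}
    (hk : facetForm k.castSucc p = o.facetBound k.castSucc) :
    k.castSucc ∈ ({1, 2, 3, 10} : Set (Fin 12)) := by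
  obtain ⟨hp, -, -, -, h₁₀⟩ := (forall_castSucc_facetForm_le_iff h₃.le).mp hp
  obtain ⟨-, hy, hz, hyz, -, -, -, -⟩ := mem_modelCupola.mp hp
  replace h₁₀ : p 0 + p 1 + p 2 ≤ o.cut3 := h₁₀
  rw [facetForm_apply] at hk
  fin_cases k <;> simp [facetBound] at hk ⊢ <;> linarith

theorem add_eq_zero_of_parallelogram (h₁ : 0 < o.cut1) (h₂ : 1 < o.cut2) (h₂' : 1 < o.cut2')
    (h₃ : o.cut3 < 2) {g : E3 →L[ℝ] ℝ} {c : ℝ} {v w : E3}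
    (hS : {x | (∀ k : Fin 11, facetForm k.castSucc x ≤ o.facetBound k.castSucc) ∧ g x = c} =
      parallelogram p v w)
    (hvw : LinearIndependent ℝ ![v, w]) (hs : ∀ x ∈ parallelogram p v w, 1 < x 1 + x 2)
    (hg : ∀ e ∈ ({cupolaTop 1, cupolaTop 2, cupolaBase 3, cupolaBase 4} : Set E3), g e ≠ 0) :
    w 1 + w 2 = 0 := by
  have hmem (x : E3) : ((∀ k : Fin 11, facetForm k.castSucc x ≤ o.facetBound k.castSucc) ∧
      g x = c) ↔ x ∈ parallelogram p v w := by
    rw [← hS, mem_ofPred_eq]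
  have hgw : g w = 0 := apply_eq_zero_of_parallelogram fun x hx =>
    ((hmem x).mpr (parallelogram_comm p v w ▸ hx)).2
  have tight_mem {q : E3} (hq : q ∈ parallelogram p v w) {k : Fin 11}
      (hk : facetForm k.castSucc q = o.facetBound k.castSucc) :
      k.castSucc ∈ ({1, 2, 3, 10} : Set (Fin 12)) :=
    mem_of_facetForm_eq h₁ h₂ h₂' h₃ ((hmem q).mpr hq).1 (hs q hq) hk
  obtain ⟨i, hi, hiw, hiv⟩ := exists_tight_along_side hS hvw
  obtain ⟨j, hj, hjw, hjv⟩ := exists_tight_along_side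
    (hS.trans (parallelogram_add_neg p v w).symm) (LinearIndependent.pair_neg_left_iff.mpr hvw)
  have hij : i.castSucc ≠ j.castSucc := by
    intro hij
    rw [← hij, map_neg] at hjv
    linarith
  rcases smul_eq_of_facetForm_eq_zero (tight_mem ⟨0, 0, by simp⟩ hi)
    (tight_mem ⟨1, 0, by simp⟩ hj) hij hiw hjw with hw | ⟨e, he, hw⟩
  · exact hw
  · rw [hw, map_smul, smul_eq_mul] at hgw
    exact (mul_eq_zero.mp hgw).resolve_right (hg e he)

theorem lt_of_parallelogram {c : ℝ} {v w : E3}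
    (hS : {x | (∀ k : Fin 11, facetForm k.castSucc x ≤ o.facetBound k.castSucc) ∧
      facetForm 11 x = c} = parallelogram p v w)
    (hvw : LinearIndependent ℝ ![v, w]) : c < 1 + o.cut3 / 2 := by
  by_contra! hc
  have hmem (x : E3) (hx : x ∈ parallelogram p v w) :
      facetForm 11 x = c ∧ facetForm 0 x = c - 2 := by
    rw [← hS, mem_ofPred_eq] at hx
    obtain ⟨hx, hxc⟩ := hx
    have h₃ : x 1 + x 2 - x 0 ≤ 2 := hx 3
    have h₁₀ : x 0 + x 1 + x 2 ≤ o.cut3 := hx 10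
    refine ⟨hxc, ?_⟩
    replace hxc : x 1 + x 2 = c := hxc
    change x 0 = c - 2
    linarith
  have hmem' := parallelogram_comm p v w ▸ hmem
  have hker : facetForm 0 (!₂[1, 0, 0] : E3) = 0 :=
    apply_eq_zero_of_linearIndependent_pair (N := facetForm 11) (g := facetForm 0)
      (finrank_euclideanSpace_fin (𝕜 := ℝ)) facetForm_eleven_ne_zero hvw
      (apply_eq_zero_of_parallelogram fun x hx => (hmem x hx).1)
      (apply_eq_zero_of_parallelogram fun x hx => (hmem' x hx).1)
      (apply_eq_zero_of_parallelogram fun x hx => (hmem x hx).2)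
      (apply_eq_zero_of_parallelogram fun x hx => (hmem' x hx).2) (by simp [facetForm_apply])
  simp [facetForm_apply] at hker

end CutOffsets

/-! ### Coordinates adapted to a cupola -/

section AffineEquiv

variable {E F : Type*} [AddCommGroup E] [Module ℝ E] [AddCommGroup F] [Module ℝ F]

theorem affineEquiv_linear_sub (ψ : E ≃ᵃ[ℝ] F) (p q : E) : ψ.linear (p - q) = ψ p - ψ q :=
  ψ.toAffineMap.linearMap_vsub p q

theorem affineEquiv_apply_add (ψ : E ≃ᵃ[ℝ] F) (p v : E) : ψ (p + v) = ψ p + ψ.linear v := by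
  simpa only [vadd_eq_add, add_comm] using ψ.map_vadd p v

theorem linear_sub_mem_vectorSpan_image (ψ : E ≃ᵃ[ℝ] F) {s : Set E} {p q : E} (hp : p ∈ s)
    (hq : q ∈ s) : ψ.linear (p - q) ∈ vectorSpan ℝ (ψ '' s) := by
  rw [affineEquiv_linear_sub]
  exact vsub_mem_vectorSpan ℝ (mem_image_of_mem ψ hp) (mem_image_of_mem ψ hq)

end AffineEquiv

namespace HalfSpace

/-- In the affine coordinates `ψ`, the half-space `H` is `{p | N p ≤ c}`. The factor `r` accounts
for the normalization of the normal vector of `H`. -/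
def HasEquation (H : HalfSpace) (ψ : E3 ≃ᵃ[ℝ] E3) (N : E3 →L[ℝ] ℝ) (c : ℝ) : Prop :=
  ∃ r > 0, ∀ p, inner ℝ H.normal (ψ p) - H.offset = r * (N p - c)

variable {H : HalfSpace} {ψ : E3 ≃ᵃ[ℝ] E3} {N : E3 →L[ℝ] ℝ} {c : ℝ}

theorem exists_hasEquation (H : HalfSpace) (ψ : E3 ≃ᵃ[ℝ] E3) :
    ∃ (N : E3 →L[ℝ] ℝ) (c : ℝ), H.HasEquation ψ N c := by
  refine ⟨innerSL ℝ H.normal ∘L LinearMap.toContinuousLinearMap (ψ.linear : E3 →ₗ[ℝ] E3),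
    H.offset - inner ℝ H.normal (ψ 0), 1, one_pos, fun p => ?_⟩
  rw [← zero_add p, affineEquiv_apply_add, inner_add_right, zero_add]
  simp only [ContinuousLinearMap.comp_apply, innerSL_apply_apply,
    LinearMap.coe_toContinuousLinearMap', LinearEquiv.coe_coe]
  ring

namespace HasEquation

theorem mem_carrier_iff (h : H.HasEquation ψ N c) {p : E3} : ψ p ∈ H.carrier ↔ N p ≤ c := by
  obtain ⟨r, hr, h⟩ := h
  rw [← sub_nonneg, ← mul_nonneg_iff_of_pos_left hr, ← neg_sub, mul_neg, ← h, neg_sub, sub_nonneg]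
  rfl

theorem mem_plane_iff (h : H.HasEquation ψ N c) {p : E3} : ψ p ∈ H.plane ↔ N p = c := by
  obtain ⟨r, hr, h⟩ := h
  rw [← sub_eq_zero (a := N p), ← mul_eq_zero_iff_left hr.ne', ← h, sub_eq_zero]
  rfl

theorem keeps_iff (h : H.HasEquation ψ N c) {p : E3} : H.Keeps (ψ p) ↔ N p < c := by
  obtain ⟨r, hr, h⟩ := h
  rw [← sub_pos, ← mul_pos_iff_of_pos_left hr, ← neg_sub, mul_neg, ← h, neg_sub, sub_pos, Keeps]

theorem removes_iff (h : H.HasEquation ψ N c) {p : E3} : H.Removes (ψ p) ↔ c < N p := by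
  obtain ⟨r, hr, h⟩ := h
  rw [← sub_pos, ← mul_pos_iff_of_pos_left hr, ← h, sub_pos, Removes]

theorem inner_linear_eq_zero (h : H.HasEquation ψ N c) {v : E3} (hv : N v = 0) :
    inner ℝ H.normal (ψ.linear v) = 0 := by
  obtain ⟨r, -, h⟩ := h
  have h0 := h 0
  have hv' := h (0 + v)
  rw [affineEquiv_apply_add, inner_add_right, map_add, hv, add_zero] at hv'
  linarith

end HasEquation

theorem exists_hasEquation_of_ker {p q : E3}
    (hker : ∀ v, N v = 0 → inner ℝ H.normal (ψ.linear v) = 0) (hp : H.Keeps (ψ p))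
    (hq : H.Removes (ψ q)) (hpq : N p < N q) : ∃ c, H.HasEquation ψ N c := by
  have hd : 0 < N (q - p) := by simpa using hpq
  obtain ⟨r, hr⟩ : ∃ r, inner ℝ H.normal (ψ.linear (q - p)) = r * N (q - p) :=
    ⟨_, (div_mul_cancel₀ _ hd.ne').symm⟩
  have hrN (v : E3) : inner ℝ H.normal (ψ.linear v) = r * N v := by
    have h := hker (v - (N v / N (q - p)) • (q - p)) (by simp [-map_sub, hd.ne', map_sub N v])
    rw [map_sub, map_smul, inner_sub_right, inner_smul_right, hr, sub_eq_zero] at h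
    rw [h]
    field_simp
  have hr0 : 0 < r := by
    refine pos_of_mul_pos_left ?_ hd.le
    rw [← hr, affineEquiv_linear_sub, inner_sub_right, sub_pos]
    exact hp.trans hq
  refine ⟨N p - (inner ℝ H.normal (ψ p) - H.offset) / r, r, hr0, fun v => ?_⟩
  have hv := hrN (v - p)
  rw [affineEquiv_linear_sub, inner_sub_right, map_sub] at hv
  field_simp
  linarith

end HalfSpace

namespace TriangularCupola

variable {C : TriangularCupola} {ψ : E3 ≃ᵃ[ℝ] E3}

/-- Affine coordinates in which `C` is the model cupola and perpendicular vectors are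
perpendicular. -/
structure IsChart (C : TriangularCupola) (ψ : E3 ≃ᵃ[ℝ] E3) : Prop where
  a_eq : ∀ i, C.a i = ψ (cupolaTop i)
  b_eq : ∀ i, C.b i = ψ (cupolaBase i)
  inner_eq_zero : ∀ u v : E3, inner ℝ u v = 0 → inner ℝ (ψ.linear u) (ψ.linear v) = 0

theorem exists_isChart (C : TriangularCupola) : ∃ ψ, C.IsChart ψ := by
  obtain ⟨f, ha, hb⟩ := C.similar_model
  obtain ⟨r, hr⟩ : ∃ r : ℝ, r = Dilation.ratio f := ⟨_, rfl⟩
  have hr0 : r ≠ 0 := hr ▸ NNReal.coe_ne_zero.mpr (Dilation.ratio_ne_zero f)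
  have hiso : Isometry fun x => r⁻¹ • f x := Isometry.of_dist_eq fun x y => by
    rw [dist_smul₀, Dilation.dist_eq, norm_inv, hr, Real.norm_of_nonneg (NNReal.coe_nonneg _),
      inv_mul_cancel_left₀ (hr ▸ hr0)]
  let scale := LinearEquiv.smulOfNeZero ℝ E3 r hr0
  let g := (IsometryEquiv.mk (f.toEquiv.trans scale.symm.toEquiv) hiso).toRealAffineIsometryEquiv
  have hg (x : E3) : f x = r • g x := (smul_inv_smul₀ hr0 (f x)).symm
  refine ⟨g.toAffineEquiv.trans scale.toAffineEquiv, fun i => (ha i).trans (hg _),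
    fun i => (hb i).trans (hg _), fun u v huv => ?_⟩
  change inner ℝ (r • g.linearIsometryEquiv u) (r • g.linearIsometryEquiv v) = 0
  rw [inner_smul_left, inner_smul_right, LinearIsometryEquiv.inner_map_map, huv, mul_zero, mul_zero]

namespace IsChart

theorem solid_eq (hψ : C.IsChart ψ) : C.solid = ψ '' modelCupola := by
  rw [modelCupola_eq_convexHull, ← ψ.coe_toAffineMap, ψ.toAffineMap.image_convexHull, image_union,
    ← range_comp, ← range_comp, solid, funext hψ.a_eq, funext hψ.b_eq]
  rfl

theorem mem_solid_iff (hψ : C.IsChart ψ) {p : E3} : ψ p ∈ C.solid ↔ p ∈ modelCupola := by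
  rw [hψ.solid_eq, ψ.injective.mem_set_image]

theorem inner_linear_eq_zero_of_mem_vectorSpan (hψ : C.IsChart ψ) {s : Set E3} {n w : E3}
    (hw : ∀ p ∈ s, ∀ q ∈ s, inner ℝ (p - q) w = 0) (hn : n ∈ vectorSpan ℝ (ψ '' s)) :
    inner ℝ n (ψ.linear w) = 0 := by
  have hle : vectorSpan ℝ (ψ '' s) ≤ (ℝ ∙ ψ.linear w)ᗮ := by
    rw [vectorSpan_def, Submodule.span_le]
    rintro _ ⟨_, ⟨p, hp, rfl⟩, _, ⟨q, hq, rfl⟩, rfl⟩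
    change ψ p - ψ q ∈ (ℝ ∙ ψ.linear w)ᗮ
    rw [← affineEquiv_linear_sub]
    exact Submodule.mem_orthogonal_singleton_iff_inner_left.mpr
      (hψ.inner_eq_zero _ _ (hw p hp q hq))
  exact Submodule.mem_orthogonal_singleton_iff_inner_left.mp (hle hn)

theorem baseDirection_eq (hψ : C.IsChart ψ) :
    C.baseDirection = vectorSpan ℝ (ψ '' range cupolaBase) := by
  rw [baseDirection, funext hψ.b_eq, ← range_comp]
  rfl

theorem t₁Direction_eq (hψ : C.IsChart ψ) :
    C.t₁Direction = vectorSpan ℝ (ψ '' {cupolaTop 0, cupolaBase 3, cupolaBase 4}) := by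
  rw [t₁Direction, hψ.a_eq, hψ.b_eq, hψ.b_eq, image_insert_eq, image_pair]

theorem linear_mem_baseDirection (hψ : C.IsChart ψ) {v : E3} (hv : facetForm 10 v = 0) :
    ψ.linear v ∈ C.baseDirection := by
  replace hv : v 0 + v 1 + v 2 = 0 := hv
  have hv_eq : v = -v 0 • (cupolaBase 3 - cupolaBase 2) + -v 1 • (cupolaBase 4 - cupolaBase 3) := by
    ext i
    fin_cases i <;> simp [cupolaBase]
    linarith
  rw [hv_eq, map_add, map_smul, map_smul, hψ.baseDirection_eq]
  exact add_mem (Submodule.smul_mem _ _ (linear_sub_mem_vectorSpan_image ψ ⟨3, rfl⟩ ⟨2, rfl⟩))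
    (Submodule.smul_mem _ _ (linear_sub_mem_vectorSpan_image ψ ⟨4, rfl⟩ ⟨3, rfl⟩))

theorem linear_mem_t₁Direction (hψ : C.IsChart ψ) {v : E3} (hv : facetForm 7 v = 0) :
    ψ.linear v ∈ C.t₁Direction := by
  replace hv : v 0 - v 1 - v 2 = 0 := hv
  have hv_eq : v = -v 2 • (cupolaBase 3 - cupolaTop 0) + -v 1 • (cupolaBase 4 - cupolaTop 0) := by
    ext i
    fin_cases i <;> simp [cupolaBase, cupolaTop]
    linarith
  rw [hv_eq, map_add, map_smul, map_smul, hψ.t₁Direction_eq]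
  exact add_mem (Submodule.smul_mem _ _ (linear_sub_mem_vectorSpan_image ψ (by simp) (by simp)))
    (Submodule.smul_mem _ _ (linear_sub_mem_vectorSpan_image ψ (by simp) (by simp)))

theorem inner_linear_eq_zero (hψ : C.IsChart ψ) {n v : E3}
    (hn : n ∈ C.baseDirection ∧ n ∈ C.t₁Direction) (hv : v 1 = v 2) :
    inner ℝ n (ψ.linear v) = 0 := by
  have hbase : inner ℝ n (ψ.linear !₂[1, 1, 1]) = 0 := by
    refine hψ.inner_linear_eq_zero_of_mem_vectorSpan ?_ (hψ.baseDirection_eq ▸ hn.1)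
    rintro _ ⟨i, rfl⟩ _ ⟨j, rfl⟩
    fin_cases i <;> fin_cases j <;> simp [cupolaBase, PiLp.inner_apply, Fin.sum_univ_three]
  have ht₁ : inner ℝ n (ψ.linear !₂[-1, 1, 1]) = 0 := by
    refine hψ.inner_linear_eq_zero_of_mem_vectorSpan ?_ (hψ.t₁Direction_eq ▸ hn.2)
    rintro _ (rfl | rfl | rfl) _ (rfl | rfl | rfl) <;>
      simp [cupolaTop, cupolaBase, PiLp.inner_apply, Fin.sum_univ_three]
  have hv_eq : v = ((v 1 + v 0) / 2) • !₂[1, 1, 1] + ((v 1 - v 0) / 2) • !₂[-1, 1, 1] := by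
    ext i
    fin_cases i <;> simp [← hv] <;> ring
  rw [hv_eq, map_add, map_smul, map_smul, inner_add_right, inner_smul_right, inner_smul_right,
    hbase, ht₁, mul_zero, mul_zero, add_zero]

end IsChart

theorem IsChart.ne_of_disjoint_planes (hψ : C.IsChart ψ) {H H' : HalfSpace}
    {N N' : E3 →L[ℝ] ℝ} {c c' : ℝ} (hH : H.HasEquation ψ N c) (hH' : H'.HasEquation ψ N' c')
    (hdisj : Disjoint (C.solid ∩ H.plane) (C.solid ∩ H'.plane)) {p : E3} (hp : p ∈ modelCupola)
    (hN : N p = c) : N' p ≠ c' := fun hN' =>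
  disjoint_left.mp hdisj ⟨hψ.mem_solid_iff.mpr hp, hH.mem_plane_iff.mpr hN⟩
    ⟨hψ.mem_solid_iff.mpr hp, hH'.mem_plane_iff.mpr hN'⟩

namespace Equitruncation

variable {K : C.Equitruncation} {o : CutOffsets}

/-- In the coordinates `ψ`, all cuts of `K` but the last are made by the planes with offsets `o`. -/
structure HasFirstOffsets (K : C.Equitruncation) (ψ : E3 ≃ᵃ[ℝ] E3) (o : CutOffsets) : Prop where
  isChart : C.IsChart ψ
  cut1 : K.cut1.HasEquation ψ (facetForm 7) o.cut1
  cut2 : K.cut2.HasEquation ψ (facetForm 8) o.cut2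
  cut2' : K.cut2'.HasEquation ψ (facetForm 9) o.cut2'
  cut3 : K.cut3.HasEquation ψ (facetForm 10) o.cut3

/-- In the coordinates `ψ`, the cuts of `K` are made by the planes with offsets `o`. -/
structure HasOffsets (K : C.Equitruncation) (ψ : E3 ≃ᵃ[ℝ] E3) (o : CutOffsets) : Prop extends
    K.HasFirstOffsets ψ o where
  cut4 : K.cut4.HasEquation ψ (facetForm 11) o.cut4

theorem exists_hasFirstOffsets (K : C.Equitruncation) (hψ : C.IsChart ψ) :
    ∃ o : CutOffsets, K.HasFirstOffsets ψ o := by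
  have normal_inner {H : HalfSpace} {v : E3} (hv : v ∈ H.direction) : inner ℝ H.normal v = 0 :=
    Submodule.mem_orthogonal_singleton_iff_inner_right.mp hv
  obtain ⟨c₁, h₁⟩ := HalfSpace.exists_hasEquation_of_ker (N := facetForm 7)
    (fun v hv => normal_inner (K.cut1_parallel ▸ hψ.linear_mem_t₁Direction hv))
    (hψ.a_eq 2 ▸ K.cut1_edge₂.1) (hψ.b_eq 1 ▸ K.cut1_edge₂.2)
    (by simp [facetForm_apply, cupolaTop, cupolaBase])
  obtain ⟨c₂, h₂⟩ := HalfSpace.exists_hasEquation_of_ker (N := facetForm 8)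
    (fun v hv => hψ.inner_linear_eq_zero K.cut2_perp (sub_eq_zero.mp hv))
    (hψ.a_eq 2 ▸ K.cut2_edge.1) (hψ.b_eq 2 ▸ K.cut2_edge.2)
    (by simp [facetForm_apply, cupolaTop, cupolaBase])
  obtain ⟨c₂', h₂'⟩ := HalfSpace.exists_hasEquation_of_ker (N := facetForm 9)
    (fun v hv => hψ.inner_linear_eq_zero K.cut2'_perp (sub_eq_zero.mp hv).symm)
    (hψ.a_eq 1 ▸ K.cut2'_edge.1) (hψ.b_eq 5 ▸ K.cut2'_edge.2)
    (by simp [facetForm_apply, cupolaTop, cupolaBase])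
  obtain ⟨c₃, h₃⟩ := HalfSpace.exists_hasEquation_of_ker (N := facetForm 10)
    (fun v hv => normal_inner (K.cut3_parallel ▸ hψ.linear_mem_baseDirection hv))
    (hψ.b_eq 2 ▸ K.cut3_top.2 2) (hψ.a_eq 0 ▸ K.cut3_top.1 0)
    (by simp [facetForm_apply, cupolaTop, cupolaBase])
  exact ⟨⟨c₁, c₂, c₂', c₃, 0⟩, hψ, h₁, h₂, h₂', h₃⟩

namespace HasFirstOffsets

theorem cut1_mem (h : K.HasFirstOffsets ψ o) : o.cut1 ∈ Ioo 0 2 := by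
  have h₁ := K.cut1_edge₂
  rw [h.isChart.a_eq, h.isChart.b_eq, h.cut1.keeps_iff, h.cut1.removes_iff] at h₁
  simp only [facetForm_apply, cupolaTop, cupolaBase, Matrix.cons_val] at h₁
  constructor <;> linarith [h₁.1, h₁.2]

theorem cut2_mem (h : K.HasFirstOffsets ψ o) : o.cut2 ∈ Ioo 1 2 := by
  have h₂ := K.cut2_edge
  rw [h.isChart.a_eq, h.isChart.b_eq, h.cut2.keeps_iff, h.cut2.removes_iff] at h₂
  simp only [facetForm_apply, cupolaTop, cupolaBase, Matrix.cons_val] at h₂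
  constructor <;> linarith [h₂.1, h₂.2]

theorem cut2'_mem (h : K.HasFirstOffsets ψ o) : o.cut2' ∈ Ioo 1 2 := by
  have h₂ := K.cut2'_edge
  rw [h.isChart.a_eq, h.isChart.b_eq, h.cut2'.keeps_iff, h.cut2'.removes_iff] at h₂
  simp only [facetForm_apply, cupolaTop, cupolaBase, Matrix.cons_val] at h₂
  constructor <;> linarith [h₂.1, h₂.2]

theorem cut3_mem (h : K.HasFirstOffsets ψ o) : o.cut3 ∈ Ioo 0 2 := by
  have h₃ := And.intro (K.cut3_top.2 0) (K.cut3_top.1 0)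
  rw [h.isChart.a_eq, h.isChart.b_eq, h.cut3.keeps_iff, h.cut3.removes_iff] at h₃
  simp only [facetForm_apply, cupolaTop, cupolaBase, Matrix.cons_val] at h₃
  constructor <;> linarith [h₃.1, h₃.2]

theorem cut2_cut1 (h : K.HasFirstOffsets ψ o) : 2 * (2 - o.cut2) < o.cut1 := by
  obtain ⟨⟨_, _⟩, _, _⟩ := And.intro h.cut1_mem h.cut2_mem
  by_contra!
  refine h.isChart.ne_of_disjoint_planes h.cut1 h.cut2 K.disjoint_cut1_cut2
    (p := !₂[2 - o.cut2, 1 - o.cut1 / 2, 1 - o.cut1 / 2 - o.cut2]) (mem_modelCupola.mpr ?_) ?_ ?_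
  · simp only [Matrix.cons_val]
    and_intros <;> linarith
  all_goals
    simp only [facetForm_apply, Matrix.cons_val]
    ring

theorem cut2'_cut1 (h : K.HasFirstOffsets ψ o) : 2 * (2 - o.cut2') < o.cut1 := by
  obtain ⟨⟨_, _⟩, _, _⟩ := And.intro h.cut1_mem h.cut2'_mem
  by_contra!
  refine h.isChart.ne_of_disjoint_planes h.cut1 h.cut2' K.disjoint_cut1_cut2'
    (p := !₂[2 - o.cut2', 1 - o.cut1 / 2 - o.cut2', 1 - o.cut1 / 2]) (mem_modelCupola.mpr ?_) ?_ ?_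
  · simp only [Matrix.cons_val]
    and_intros <;> linarith
  all_goals
    simp only [facetForm_apply, Matrix.cons_val]
    ring

theorem cut2_cut3 (h : K.HasFirstOffsets ψ o) : 2 * (2 - o.cut2) < o.cut3 := by
  obtain ⟨⟨_, _⟩, _, _⟩ := And.intro h.cut2_mem h.cut3_mem
  by_contra!
  refine h.isChart.ne_of_disjoint_planes h.cut2 h.cut3 K.disjoint_cut2_cut3
    (p := !₂[2 - o.cut2, o.cut3 / 2 - 1 + o.cut2, o.cut3 / 2 - 1]) (mem_modelCupola.mpr ?_) ?_ ?_
  · simp only [Matrix.cons_val]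
    and_intros <;> linarith
  all_goals
    simp only [facetForm_apply, Matrix.cons_val]
    ring

theorem cut2'_cut3 (h : K.HasFirstOffsets ψ o) : 2 * (2 - o.cut2') < o.cut3 := by
  obtain ⟨⟨_, _⟩, _, _⟩ := And.intro h.cut2'_mem h.cut3_mem
  by_contra!
  refine h.isChart.ne_of_disjoint_planes h.cut2' h.cut3 K.disjoint_cut2'_cut3
    (p := !₂[2 - o.cut2', o.cut3 / 2 - 1, o.cut3 / 2 - 1 + o.cut2']) (mem_modelCupola.mpr ?_) ?_ ?_
  · simp only [Matrix.cons_val]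
    and_intros <;> linarith
  all_goals
    simp only [facetForm_apply, Matrix.cons_val]
    ring

theorem cut1_cut3 (h : K.HasFirstOffsets ψ o) : 2 < o.cut1 + o.cut3 := by
  obtain ⟨⟨_, _⟩, _, _⟩ := And.intro h.cut1_mem h.cut3_mem
  by_contra!
  refine h.isChart.ne_of_disjoint_planes h.cut1 h.cut3 K.disjoint_cut1_cut3
    (p := !₂[(o.cut1 + o.cut3) / 2, (o.cut3 - o.cut1) / 4, (o.cut3 - o.cut1) / 4])
    (mem_modelCupola.mpr ?_) ?_ ?_
  · simp only [Matrix.cons_val]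
    and_intros <;> linarith
  all_goals
    simp only [facetForm_apply, Matrix.cons_val]
    ring

theorem mem_iff (h : K.HasFirstOffsets ψ o) {p : E3} :
    ψ p ∈ C.solid ∩ K.cut1.carrier ∩ K.cut2.carrier ∩ K.cut2'.carrier ∩ K.cut3.carrier ↔
      ∀ k : Fin 11, facetForm k.castSucc p ≤ o.facetBound k.castSucc := by
  rw [CutOffsets.forall_castSucc_facetForm_le_iff h.cut3_mem.2.le]
  simp only [mem_inter_iff, h.isChart.mem_solid_iff, h.cut1.mem_carrier_iff, h.cut2.mem_carrier_iff,
    h.cut2'.mem_carrier_iff, h.cut3.mem_carrier_iff, and_assoc]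

theorem exists_parallelogram (h : K.HasFirstOffsets ψ o) {g : E3 →L[ℝ] ℝ} {c : ℝ}
    (h₄ : K.cut4.HasEquation ψ g c) : ∃ p v w, LinearIndependent ℝ ![v, w] ∧
      {x | (∀ k : Fin 11, facetForm k.castSucc x ≤ o.facetBound k.castSucc) ∧ g x = c} =
        parallelogram p v w := by
  obtain ⟨P, V, W, hV, hW, hVW, hR⟩ := K.cut4_rectangle
  obtain ⟨p, rfl⟩ := ψ.surjective P
  obtain ⟨v, rfl⟩ := ψ.linear.surjective V
  obtain ⟨w, rfl⟩ := ψ.linear.surjective W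
  have hindep : LinearIndependent ℝ ((ψ.linear : E3 →ₗ[ℝ] E3) ∘ ![v, w]) :=
    linearIndependent_of_ne_zero_of_inner_eq_zero (𝕜 := ℝ)
      (by simpa [Fin.forall_fin_two] using And.intro hV hW)
      (by simp [Pairwise, Fin.forall_fin_two, hVW, real_inner_comm (ψ.linear v)])
  refine ⟨p, v, w, hindep.of_comp _, ?_⟩
  ext x
  rw [mem_ofPred_eq, ← h.mem_iff, ← h₄.mem_plane_iff, ← mem_inter_iff, hR, mem_ofPred_eq]
  simp only [parallelogram, mem_ofPred_eq, ← map_smul, ← affineEquiv_apply_add, ψ.injective.eq_iff]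

theorem one_lt_add_of_apply_eq (h : K.HasFirstOffsets ψ o) {g : E3 →L[ℝ] ℝ} {c : ℝ}
    (h₄ : K.cut4.HasEquation ψ g c) {x : E3}
    (hx : ∀ k : Fin 11, facetForm k.castSucc x ≤ o.facetBound k.castSucc) (hxc : g x = c) :
    1 < x 1 + x 2 := by
  by_contra! hx1
  have hlt : x ∈ {x | g x < c} :=
    mem_of_mem_modelCupola (convex_halfSpace_lt g.isLinear c)
      (fun i hi => h₄.keeps_iff.mp (h.isChart.a_eq i ▸ K.cut4_vertex.2.1 i hi))
      (fun i => h₄.keeps_iff.mp (h.isChart.b_eq i ▸ K.cut4_vertex.2.2 i)) (.inr hx1)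
      ((CutOffsets.forall_castSucc_facetForm_le_iff h.cut3_mem.2.le).mp hx).1
  exact hlt.ne hxc

end HasFirstOffsets

theorem cut4_apply_ne_zero (hψ : C.IsChart ψ) {g : E3 →L[ℝ] ℝ} {c : ℝ}
    (h₄ : K.cut4.HasEquation ψ g c) {e : E3}
    (he : e ∈ ({cupolaTop 1, cupolaTop 2, cupolaBase 3, cupolaBase 4} : Set E3)) : g e ≠ 0 := by
  obtain ⟨ha₀, ha, hb⟩ := K.cut4_vertex
  simp only [hψ.a_eq, hψ.b_eq, h₄.removes_iff, h₄.keeps_iff] at ha₀ ha hb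
  -- The edge `a 0, e` is one side of a parallelogram whose corner opposite `a 0` is the origin.
  have hadd₁ : cupolaTop 0 = cupolaTop 1 + cupolaBase 3 := by
    ext i; fin_cases i <;> simp [cupolaTop, cupolaBase]
  have hadd₂ : cupolaTop 0 = cupolaTop 2 + cupolaBase 4 := by
    ext i; fin_cases i <;> simp [cupolaTop, cupolaBase]
  have h₁₃ := congrArg g hadd₁
  have h₂₄ := congrArg g hadd₂
  rw [map_add] at h₁₃ h₂₄
  intro h0
  rcases he with rfl | rfl | rfl | rfl
  · linarith [hb 3]
  · linarith [hb 4]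
  · linarith [ha 1 (by decide)]
  · linarith [ha 2 (by decide)]

theorem exists_hasOffsets (K : C.Equitruncation) (hψ : C.IsChart ψ) :
    ∃ o : CutOffsets, K.HasOffsets ψ o := by
  obtain ⟨o, h⟩ := K.exists_hasFirstOffsets hψ
  obtain ⟨g, d, h₄⟩ := K.cut4.exists_hasEquation ψ
  obtain ⟨p, v, w, hvw, hS⟩ := h.exists_parallelogram h₄
  have hmem {x : E3} (hx : x ∈ parallelogram p v w) :
      (∀ k : Fin 11, facetForm k.castSucc x ≤ o.facetBound k.castSucc) ∧ g x = d := by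
    rwa [← hS, mem_ofPred_eq] at hx
  have hcomm := parallelogram_comm p v w
  have hs (x : E3) (hx : x ∈ parallelogram p v w) : 1 < x 1 + x 2 :=
    h.one_lt_add_of_apply_eq h₄ (hmem hx).1 (hmem hx).2
  have hNw : facetForm 11 w = 0 :=
    CutOffsets.add_eq_zero_of_parallelogram h.cut1_mem.1 h.cut2_mem.1 h.cut2'_mem.1 h.cut3_mem.2
      hS hvw hs fun _ => cut4_apply_ne_zero hψ h₄
  have hNv : facetForm 11 v = 0 :=
    CutOffsets.add_eq_zero_of_parallelogram h.cut1_mem.1 h.cut2_mem.1 h.cut2'_mem.1 h.cut3_mem.2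
      (hS.trans hcomm) (LinearIndependent.pair_symm_iff.mp hvw) (hcomm ▸ hs)
      fun _ => cut4_apply_ne_zero hψ h₄
  have hgv : g v = 0 := apply_eq_zero_of_parallelogram fun x hx => (hmem hx).2
  have hgw : g w = 0 := apply_eq_zero_of_parallelogram fun x hx => (hmem (hcomm ▸ hx)).2
  have hker (u : E3) (hu : facetForm 11 u = 0) : g u = 0 :=
    apply_eq_zero_of_linearIndependent_pair (g := g) (finrank_euclideanSpace_fin (𝕜 := ℝ))
      facetForm_eleven_ne_zero hvw hNv hNw hgv hgw hu
  obtain ⟨c, hc⟩ := HalfSpace.exists_hasEquation_of_ker (N := facetForm 11)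
    (fun u hu => h₄.inner_linear_eq_zero (hker u hu)) (hψ.b_eq 2 ▸ K.cut4_vertex.2.2 2)
    (hψ.a_eq 0 ▸ K.cut4_vertex.1) (by simp [facetForm_apply, cupolaTop, cupolaBase])
  exact ⟨{ o with cut4 := c }, ⟨hψ, h.cut1, h.cut2, h.cut2', h.cut3⟩, hc⟩

namespace HasOffsets

theorem admissible (h : K.HasOffsets ψ o) : o.Admissible where
  one_lt_cut2 := h.cut2_mem.1
  cut2_lt := h.cut2_mem.2
  one_lt_cut2' := h.cut2'_mem.1
  cut2'_lt := h.cut2'_mem.2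
  cut1_lt := h.cut1_mem.2
  cut3_lt := h.cut3_mem.2
  cut2_cut1 := h.cut2_cut1
  cut2'_cut1 := h.cut2'_cut1
  cut2_cut3 := h.cut2_cut3
  cut2'_cut3 := h.cut2'_cut3
  cut1_cut3 := h.cut1_cut3
  one_lt_cut4 := by
    have hb := h.cut4.keeps_iff.mp (h.isChart.b_eq 3 ▸ K.cut4_vertex.2.2 3)
    simpa [facetForm_apply, cupolaBase] using hb
  cut4_lt := by
    obtain ⟨p, v, w, hvw, hS⟩ := h.exists_parallelogram h.cut4
    exact CutOffsets.lt_of_parallelogram hS hvw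

theorem solid_eq (h : K.HasOffsets ψ o) : K.solid = ψ '' h.admissible.polytope.solid := by
  ext y
  obtain ⟨p, rfl⟩ := ψ.surjective y
  rw [ψ.injective.mem_set_image, solid, mem_inter_iff, h.mem_iff, h.cut4.mem_carrier_iff]
  exact (Fin.forall_fin_succ' (P := fun k => facetForm k p ≤ o.facetBound k)).symm

end HasOffsets

end Equitruncation

end TriangularCupola

theorem mainTheorem4 (C : TriangularCupola) (K : C.Equitruncation) :
    IsEquiprojective 11 K.solid := by
  obtain ⟨ψ, hψ⟩ := C.exists_isChart
  obtain ⟨o, h⟩ := K.exists_hasOffsets hψ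
  rw [h.solid_eq, ← SimplePolytope.solid_map]
  refine SimplePolytope.isEquiprojective _ fun u hu => ?_
  exact h.admissible.ncard_isSilhouette (u := ψ.symm.linear u) hu
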